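/- A flow here is a measurable flow $\mathcal T=(T^t)_{t\in\mathbb R}$ on a standard Borel probability space $(X,\mathcal B,\mu)$: an action of $\mathbb R$ by measure-preserving maps such that $t\mapsto\langle f\circ T^t,g\rangle$ is continuous for all $f,g\in L^2(\mu)$. Isomorphisms of flows are measure-preserving maps that are invertible modulo null sets and intertwine the actions almost everywhere for each $t$. A flow is weakly mixing if $\frac1R\int_0^R|\mu(A\cap T^{-t}B)-\mu(A)\mu(B)|\,dt\to0$ as $R\to\infty$ for all measurable $A,B$. An ergodic flow $\mathcal T$ on $(X,\mu)$ has the joining primeness property (JP) if for all weakly mixing flows $\mathcal S_1,\mathcal S_2$ on $(Y_1,\nu_1),(Y_2,\nu_2)$, every ergodic joining $\lambda$ of $\mathcal T$ with $\mathcal S_1\times\mathcal S_2$ satisfies $\lambda=\lambda_{X,Y_1}\otimes\nu_2$ or $\lambda=\lambda_{X,Y_2}\otimes\nu_1$, where $\lambda_{X,Y_j}$ is the projection of $\lambda$ to $X\times Y_j$. For $\alpha\in(0,1)$ and $t_n\to\infty$, $\mathcal T$ is $\alpha$-weakly mixing along $(t_n)$ if $\langle f\circ T^{t_n},g\rangle\to\alpha\int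 f\,d\mu\int\bar g\,d\mu+(1-\alpha)\langle f,g\rangle$ for all $f,g\in L^2(\mu)$. **Theorem.** Let $\mathcal T_1,\dots,\mathcal T_d$ and $\mathcal S_1,\dots,\mathcal S_d$ be flows on $(X_i,\mathcal B_i,\mu_i)$ and $(Y_i,\mathcal C_i,\nu_i)$, where no $\nu_i$ is a point mass, and let $\Phi\colon Y_1\times\dots\times Y_d\to X_1\times\dots\times X_d$ be an isomorphism of $\mathcal S_1\times\dots\times\mathcal S_d$ with $\mathcal T_1\times\dots\times\mathcal T_d$. Suppose that one of the following holds: (i) each $\mathcal T_i$ is weakly mixing and has the JP property; (ii) there are $t_n\to\infty$ and $\alpha_1,\dots,\alpha_d\in(0,1)$ such that each $\mathcal T_i$ is $\alpha_i$-weakly mixing along $(t_n)$, and each $\mathcal S_i$ is weakly mixing. Then there is a permutation $\sigma$ of $\{1,\dots,d\}$ such that $\mathcal T_i$ is isomorphic to $\mathcal S_{\sigma(i)}$ for every $i$. More precisely, these isomorphisms are restrictions of $\Phi$ to the coordinate $\sigma$-algebras: for every $i$ there is an isomorphism $\varphi_i\colon Y_{\sigma(i)}\to X_i$ of $\mathcal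 S_{\sigma(i)}$ with $\mathcal T_i$ such that $\Phi(y)_i=\varphi_i(y_{\sigma(i)})$ for almost every $y$. -/

import Mathlib

open MeasureTheory Filter Topology

universe u

namespace MeasFlow

/-- `(T^t)` is a measurable flow on `(X, μ)`: an action of `ℝ` by measure-preserving maps such that
`t ↦ ⟨f ∘ T^t, g⟩` is continuous for all `f, g ∈ L²(X, μ)`. -/
structure IsMeasurableFlow {X : Type*} [MeasurableSpace X] (T : ℝ → X → X) (μ : Measure X) :
    Prop where
  map_zero : ∀ x, T 0 x = x
  map_add : ∀ s t x, T (s + t) x = T s (T t x)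
  measurePreserving : ∀ t, MeasurePreserving (T t) μ μ
  continuous_inner : ∀ f g : X → ℂ, MemLp f 2 μ → MemLp g 2 μ →
    Continuous fun t : ℝ => ∫ x, f (T t x) * starRingEnd ℂ (g x) ∂μ

/-- Ergodicity: a measurable set that is invariant mod null sets under every `T^t` is null or
conull. -/
def IsErgodic {X : Type*} [MeasurableSpace X] (T : ℝ → X → X) (μ : Measure X) : Prop :=
  ∀ A : Set X, MeasurableSet A → (∀ t, T t ⁻¹' A =ᵐ[μ] A) → μ A = 0 ∨ μ Aᶜ = 0

/-- Weak mixing: `(1/R) ∫₀ᴿ |μ(A ∩ T^{-t} B) - μ(A) μ(B)| dt → 0` as `R → ∞`, for all measurable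
`A`, `B`. -/
def IsWeaklyMixing {X : Type*} [MeasurableSpace X] (T : ℝ → X → X) (μ : Measure X) : Prop :=
  ∀ A B : Set X, MeasurableSet A → MeasurableSet B →
    Tendsto
      (fun R : ℝ => R⁻¹ * ∫ t in (0 : ℝ)..R, |μ.real (A ∩ T t ⁻¹' B) - μ.real A * μ.real B|)
      atTop (𝓝 0)

/-- The product `T × S` of two flows. -/
def prod {X Y : Type*} (T : ℝ → X → X) (S : ℝ → Y → Y) : ℝ → X × Y → X × Y :=
  fun t p => (T t p.1, S t p.2)

/-- The product of a family of flows. -/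
def pi {ι : Type*} {X : ι → Type*} (T : ∀ i, ℝ → X i → X i) : ℝ → (∀ i, X i) → ∀ i, X i :=
  fun t x i => T i t (x i)

/-- `l` is a joining of the flows `(T, μ)` and `(S, ν)`: a `T^t × S^t`-invariant measure on `X × Y`
with marginals `μ` and `ν`. -/
structure IsJoining {X Y : Type*} [MeasurableSpace X] [MeasurableSpace Y]
    (T : ℝ → X → X) (μ : Measure X) (S : ℝ → Y → Y) (ν : Measure Y) (l : Measure (X × Y)) :
    Prop where
  invariant : ∀ t, l.map (prod T S t) = l
  map_fst : l.map Prod.fst = μ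
  map_snd : l.map Prod.snd = ν

/-- The joining primeness property: the flow is ergodic, and every ergodic joining `l` of it with
a product `S₁ × S₂` of weakly mixing flows (on standard Borel probability spaces) is
`l_{X,Y₁} ⊗ ν₂` or `l_{X,Y₂} ⊗ ν₁`, where `l_{X,Yⱼ}` is the projection of `l` to `X × Yⱼ`. -/
structure HasJP {X : Type u} [MeasurableSpace X] (T : ℝ → X → X) (μ : Measure X) : Prop where
  ergodic : IsErgodic T μ
  joining : ∀ (Y₁ Y₂ : Type u) [MeasurableSpace Y₁] [MeasurableSpace Y₂]
    [StandardBorelSpace Y₁] [StandardBorelSpace Y₂]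
    (ν₁ : Measure Y₁) (ν₂ : Measure Y₂) [IsProbabilityMeasure ν₁] [IsProbabilityMeasure ν₂]
    (S₁ : ℝ → Y₁ → Y₁) (S₂ : ℝ → Y₂ → Y₂),
    IsMeasurableFlow S₁ ν₁ → IsMeasurableFlow S₂ ν₂ →
    IsWeaklyMixing S₁ ν₁ → IsWeaklyMixing S₂ ν₂ →
    ∀ l : Measure (X × (Y₁ × Y₂)),
      IsJoining T μ (prod S₁ S₂) (ν₁.prod ν₂) l → IsErgodic (prod T (prod S₁ S₂)) l →
      l = ((l.map fun p => (p.1, p.2.1)).prod ν₂).map (fun q => (q.1.1, (q.1.2, q.2))) ∨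
      l = ((l.map fun p => (p.1, p.2.2)).prod ν₁).map (fun q => (q.1.1, (q.2, q.1.2)))

/-- `T` is `α`-weakly mixing along `tₙ`: `T^{tₙ} → α Π + (1 - α) Id` in the weak operator topology
of `L²(X, μ)`, where `T^t f = f ∘ T^t` and `Π f = ∫ f dμ`. -/
def IsAlphaWeaklyMixing {X : Type*} [MeasurableSpace X] (T : ℝ → X → X) (μ : Measure X)
    (α : ℝ) (t : ℕ → ℝ) : Prop :=
  ∀ f g : X → ℂ, MemLp f 2 μ → MemLp g 2 μ →
    Tendsto (fun n => ∫ x, f (T (t n) x) * starRingEnd ℂ (g x) ∂μ) atTop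
      (𝓝 ((α : ℂ) * ((∫ x, f x ∂μ) * ∫ x, starRingEnd ℂ (g x) ∂μ)
        + (1 - (α : ℂ)) * ∫ x, f x * starRingEnd ℂ (g x) ∂μ))

/-- `Φ : Y → X` is an isomorphism of the flow `(S, ν)` with the flow `(T, μ)`: measure-preserving,
invertible mod null sets, and `Φ ∘ S^t = T^t ∘ Φ` almost everywhere for every `t`. -/
structure IsIsomorphism {X Y : Type*} [MeasurableSpace X] [MeasurableSpace Y]
    (S : ℝ → Y → Y) (ν : Measure Y) (T : ℝ → X → X) (μ : Measure X) (Φ : Y → X) : Prop where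
  measurePreserving : MeasurePreserving Φ ν μ
  exists_inverse : ∃ Ψ : X → Y, MeasurePreserving Ψ μ ν ∧
    (∀ᵐ y ∂ν, Ψ (Φ y) = y) ∧ (∀ᵐ x ∂μ, Φ (Ψ x) = x)
  intertwines : ∀ t, ∀ᵐ y ∂ν, Φ (S t y) = T t (Φ y)

/-- The measure is not trivial: some measurable set is neither null nor conull. On a standard
Borel probability space this says that the measure is not a point mass. -/
def IsNontrivial {X : Type*} [MeasurableSpace X] (μ : Measure X) : Prop :=
  ∃ A : Set X, MeasurableSet A ∧ μ A ≠ 0 ∧ μ Aᶜ ≠ 0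

/-- `Φ : Y₁ × ⋯ × Y_d → X₁ × ⋯ × X_d` restricts, on the coordinate `σ`-algebras, to isomorphisms of
the `S_{σ(i)}` with the `T_i`: the `i`-th coordinate of `Φ` depends (a.e.) on the `σ(i)`-th
coordinate only, through an isomorphism `φ : Y_{σ(i)} → X_i`; that is,
`(f ∘ π_i) ∘ Φ = (f ∘ φ) ∘ π_{σ(i)}` for every function `f` on `X_i`. -/
def RestrictsToCoordinates {d : ℕ} {X Y : Fin d → Type*}
    [∀ i, MeasurableSpace (X i)] [∀ i, MeasurableSpace (Y i)]
    (S : ∀ i, ℝ → Y i → Y i) (ν : ∀ i, Measure (Y i)) [∀ i, IsProbabilityMeasure (ν i)]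
    (T : ∀ i, ℝ → X i → X i) (μ : ∀ i, Measure (X i))
    (Φ : (∀ i, Y i) → ∀ i, X i) (σ : Equiv.Perm (Fin d)) : Prop :=
  ∀ i, ∃ φ : Y (σ i) → X i,
    IsIsomorphism (S (σ i)) (ν (σ i)) (T i) (μ i) φ ∧
    ∀ᵐ y ∂(Measure.pi ν), Φ y i = φ (y (σ i))

end MeasFlow

namespace MeasFlow

set_option linter.unusedSectionVars false

/-! A function `f` on a product space depends a.e. only on the coordinates in `A` exactly when
resampling the other coordinates does not change it (`DependsOnAE`). Such `A` are closed under
supersets and intersections. It suffices that each coordinate of `Φ` depends on a single coordinate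
`j i`: since `Φ` is invertible and no `ν i` is trivial, `j` is onto, hence a permutation, and the
inverse `Ψ` splits in the same way.

Under (i), the law of `(Φ y i, y)` is an ergodic joining of `T i` with the product of the flows in
`A` and those in `Aᶜ`. JP makes it a product, and as `Φ y i` is a function of `y`, it must depend on
`A` alone or on `Aᶜ` alone (`HasJP.dependsOnAE_or`). Applying this to singletons and intersecting
complements isolates one coordinate.

Under (ii), the graph couplings of the product flow at times `t n` converge on rectangles to the law
of `(x, x')`, where `x'` resamples coordinate `i` of `x` with probability `α i`, independently over
`i`. Seen through `Ψ`, the graph couplings are products, so the pairs `(Ψ x j, Ψ x' j)` are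
independent in the limit (`indepFun_resampleCoupling`). Let `B j` be the least set on which `Ψ · j`
depends. By ergodicity of the doubled flow (`real_resample_eq_ite`), `Ψ x j = Ψ x' j` has
probability `∏ i ∈ B j, (1 - α i)`, and for `j` and `k` jointly the product runs over `B j ∪ B k`.
Independence then forces `B j` and `B k` to be disjoint; `d` disjoint nonempty subsets of `Fin d`
are singletons. -/

theorem ae_of_ae_comp {α β : Type*} [MeasurableSpace α] [MeasurableSpace β] {a : Measure α}
    {b : Measure β} {g : α → β} (hg : MeasurePreserving g a b) {p : β → Prop}
    (hp : MeasurableSet {x | p x}) (h : ∀ᵐ x ∂a, p (g x)) : ∀ᵐ x ∂b, p x := by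
  rw [← hg.map_eq, ae_map_iff hg.aemeasurable hp]
  exact h

/-- A set `A` neither null nor conull would give the rectangle `f ⁻¹' A ×ˢ f ⁻¹' Aᶜ` positive
measure, yet `f p.1 ≠ f p.2` on it. -/
theorem not_isNontrivial_of_ae_eq {Ω : Type*} {Z : Type*} [MeasurableSpace Ω] [MeasurableSpace Z]
    {P : Measure Ω} [SFinite P] {ρ : Measure Z} {f : Ω → Z} (hf : MeasurePreserving f P ρ)
    (h : ∀ᵐ p ∂(P.prod P), f p.2 = f p.1) : ¬ IsNontrivial ρ := by
  rintro ⟨A, hA, h0, h1⟩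
  have h2 : (P.prod P) ((f ⁻¹' A) ×ˢ (f ⁻¹' Aᶜ)) = 0 := by
    refine measure_mono_null ?_ h
    rintro p ⟨h3, h4⟩ h5
    rw [Set.mem_preimage, h5] at h4
    exact h4 h3
  rw [Measure.prod_prod, hf.measure_preimage hA.nullMeasurableSet,
    hf.measure_preimage hA.compl.nullMeasurableSet, mul_eq_zero] at h2
  exact h2.elim h0 h1

theorem measurable_piecewise {ι : Type*} [DecidableEq ι] {Y : ι → Type*}
    [∀ i, MeasurableSpace (Y i)] (A : Finset ι) :
    Measurable fun p : (∀ i, Y i) × (∀ i, Y i) => A.piecewise p.1 p.2 := by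
  refine measurable_pi_iff.2 fun i => ?_
  by_cases hi : i ∈ A
  · simp only [Finset.piecewise, hi, if_true]; fun_prop
  · simp only [Finset.piecewise, hi, if_false]; fun_prop

/-! ### Dependence on a set of coordinates, tested by resampling. -/

section Resampling

variable {ι : Type*} [Fintype ι] [DecidableEq ι] {Y : ι → Type*} [∀ i, MeasurableSpace (Y i)]
  (ν : ∀ i, Measure (Y i)) [∀ i, IsProbabilityMeasure (ν i)] {Z : Type*}

theorem prod_pi_preimage (A : Finset ι) (E F : ∀ i, Set (Y i)) :
    ((Measure.pi ν).prod (Measure.pi ν))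
      {p | p.1 ∈ Set.univ.pi E ∧ A.piecewise p.1 p.2 ∈ Set.univ.pi F} =
      ∏ i, if i ∈ A then ν i (E i ∩ F i) else ν i (E i) * ν i (F i) := by
  have : {p : (∀ i, Y i) × (∀ i, Y i) |
        p.1 ∈ Set.univ.pi E ∧ A.piecewise p.1 p.2 ∈ Set.univ.pi F} =
      (Set.univ.pi fun i => if i ∈ A then E i ∩ F i else E i) ×ˢ
        (Set.univ.pi fun i => if i ∈ A then Set.univ else F i) := by
    ext p
    simp only [Set.mem_ofPred_eq, Set.mem_pi, Set.mem_univ, true_imp_iff, Set.mem_prod,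
      Finset.piecewise, ← forall_and]
    refine forall_congr' fun i => ?_
    by_cases hi : i ∈ A <;> simp [hi]
  rw [this, Measure.prod_prod, Measure.pi_pi, Measure.pi_pi, ← Finset.prod_mul_distrib]
  refine Finset.prod_congr rfl fun i _ => ?_
  by_cases hi : i ∈ A <;> simp [hi]

theorem measurePreserving_piecewise (A : Finset ι) :
    MeasurePreserving (fun p : (∀ i, Y i) × (∀ i, Y i) => A.piecewise p.1 p.2)
      ((Measure.pi ν).prod (Measure.pi ν)) (Measure.pi ν) := by
  refine ⟨measurable_piecewise A, (Measure.pi_eq fun s hs => ?_).symm⟩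
  rw [Measure.map_apply (measurable_piecewise A) (MeasurableSet.univ_pi hs)]
  have := prod_pi_preimage ν A (fun _ => Set.univ) s
  simp only [Set.pi_univ, Set.mem_univ, true_and, Set.univ_inter, measure_univ, one_mul,
    ite_self] at this
  exact this

/-- `f` depends, almost everywhere, only on the coordinates in `A`: resampling the others does not
change it. -/
def DependsOnAE (A : Finset ι) (f : (∀ i, Y i) → Z) : Prop :=
  ∀ᵐ p ∂((Measure.pi ν).prod (Measure.pi ν)), f (A.piecewise p.1 p.2) = f p.1

variable {ν} {f : (∀ i, Y i) → Z}

theorem DependsOnAE.compl_swap {A : Finset ι} (hA : DependsOnAE ν A f) :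
    ∀ᵐ p ∂((Measure.pi ν).prod (Measure.pi ν)), f (Aᶜ.piecewise p.1 p.2) = f p.2 := by
  have hs : MeasurePreserving Prod.swap ((Measure.pi ν).prod (Measure.pi ν))
      ((Measure.pi ν).prod (Measure.pi ν)) := Measure.measurePreserving_swap
  filter_upwards [hs.quasiMeasurePreserving.ae hA] with p hp
  rw [Finset.piecewise_compl]
  exact hp

variable [MeasurableSpace Z]

theorem DependsOnAE.exists_factor {s : ι} (hf : Measurable f) (hA : DependsOnAE ν {s} f) :
    ∃ g : Y s → Z, Measurable g ∧ ∀ᵐ y ∂(Measure.pi ν), f y = g (y s) := by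
  have hs : MeasurePreserving Prod.swap ((Measure.pi ν).prod (Measure.pi ν))
      ((Measure.pi ν).prod (Measure.pi ν)) := Measure.measurePreserving_swap
  -- By Fubini the other coordinates can be frozen at one typical point `y'`.
  obtain ⟨y', hy'⟩ := (Measure.ae_ae_of_ae_prod (hs.quasiMeasurePreserving.ae hA)).exists
  refine ⟨fun z => f (Function.update y' s z), hf.comp (measurable_update y'), ?_⟩
  filter_upwards [hy'] with y hy
  simp only [Prod.swap, Finset.piecewise_singleton] at hy
  exact hy.symm

variable [StandardBorelSpace Z]

theorem measurableSet_resample (hf : Measurable f) (A : Finset ι) :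
    MeasurableSet {p : (∀ i, Y i) × (∀ i, Y i) | f (A.piecewise p.1 p.2) = f p.1} :=
  measurableSet_eq_fun (hf.comp (measurable_piecewise A)) (hf.comp measurable_fst)

/-- For independent `x, y, z`, resampling off `A` with `y` and then off `B` with `z` amounts to
resampling off `A ∩ B` with the single fresh point `B.piecewise y z`. -/
theorem DependsOnAE.inter {A B : Finset ι} (hf : Measurable f) (hA : DependsOnAE ν A f)
    (hB : DependsOnAE ν B f) : DependsOnAE ν (A ∩ B) f := by
  set P := Measure.pi ν
  have g1 : MeasurePreserving Prod.fst ((P.prod P).prod P) (P.prod P) := measurePreserving_fst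
  have g2 := (measurePreserving_piecewise ν A).prod (MeasurePreserving.id P)
  have g3 := ((MeasurePreserving.id P).prod (measurePreserving_piecewise ν B)).comp
    (measurePreserving_prodAssoc P P P)
  refine ae_of_ae_comp g3 (measurableSet_resample hf _) ?_
  filter_upwards [g1.quasiMeasurePreserving.ae hA, g2.quasiMeasurePreserving.ae hB] with q h1 h2
  simp only [Prod.map, id, Function.comp, MeasurableEquiv.prodAssoc, MeasurableEquiv.coe_mk,
    Equiv.prodAssoc_apply] at h1 h2 ⊢
  rw [← h1, ← h2]
  congr 1
  ext i
  by_cases hi : i ∈ A <;> by_cases hj : i ∈ B <;> simp [Finset.piecewise, hi, hj]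

/-- With a third independent point `z`, both `f x` and `f (B.piecewise x y)` equal `f (A.piecewise x
z)`, because `B.piecewise x y` agrees with `x` on `A`. -/
theorem DependsOnAE.mono {A B : Finset ι} (hf : Measurable f) (hA : DependsOnAE ν A f)
    (hAB : A ⊆ B) : DependsOnAE ν B f := by
  set P := Measure.pi ν
  have g1 : MeasurePreserving Prod.fst ((P.prod P).prod P) (P.prod P) := measurePreserving_fst
  have g2 := (measurePreserving_piecewise ν B).prod (MeasurePreserving.id P)
  have g3 : MeasurePreserving (Prod.map Prod.fst id) ((P.prod P).prod P) (P.prod P) :=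
    (measurePreserving_fst (μ := P) (ν := P)).prod (MeasurePreserving.id P)
  refine ae_of_ae_comp g1 (measurableSet_resample hf _) ?_
  filter_upwards [g2.quasiMeasurePreserving.ae hA, g3.quasiMeasurePreserving.ae hA] with q h1 h2
  simp only [Prod.map, id] at h1 h2 ⊢
  rw [← h1, ← h2]
  congr 1
  ext i
  by_cases hi : i ∈ A
  · simp [Finset.piecewise, hi, hAB hi]
  · simp [Finset.piecewise, hi]

end Resampling

/-! ### From single-coordinate dependence to coordinate isomorphisms. -/

section Coordinates

variable {d : ℕ} {X Y : Fin d → Type u} [∀ i, MeasurableSpace (X i)] [∀ i, MeasurableSpace (Y i)]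
  [∀ i, StandardBorelSpace (X i)] [∀ i, StandardBorelSpace (Y i)]
  {μ : ∀ i, Measure (X i)} {ν : ∀ i, Measure (Y i)}
  [∀ i, IsProbabilityMeasure (μ i)] [∀ i, IsProbabilityMeasure (ν i)]
  {Φ : (∀ i, Y i) → ∀ i, X i} {Ψ : (∀ i, X i) → ∀ i, Y i}

/-- If `k` were missed, resampling `y k` would leave `Φ y`, and so `y = Ψ (Φ y)`, unchanged: `y k`
would equal an independent copy of itself. -/
theorem surjective_of_dependsOnAE (hν : ∀ i, IsNontrivial (ν i))
    (hΦ : Measurable Φ) (hΨΦ : ∀ᵐ y ∂Measure.pi ν, Ψ (Φ y) = y) {j : Fin d → Fin d}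
    (hj : ∀ i, DependsOnAE ν {j i} fun y => Φ y i) : Function.Surjective j := by
  intro k
  by_contra! hk
  have h1 : ∀ i, DependsOnAE ν {k}ᶜ fun y => Φ y i := fun i =>
    (hj i).mono ((measurable_pi_apply i).comp hΦ) (by simpa using fun e => hk i e.symm)
  refine not_isNontrivial_of_ae_eq (measurePreserving_eval ν k) ?_ (hν k)
  filter_upwards [ae_all_iff.2 h1,
    (measurePreserving_piecewise ν {k}ᶜ).quasiMeasurePreserving.ae hΨΦ,
    measurePreserving_fst.quasiMeasurePreserving.ae hΨΦ] with p h2 h3 h4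
  rw [show Φ _ = Φ p.1 from funext h2, h4] at h3
  simpa using (congrFun h3 k).symm

/-- For independent `y, y'`, the point agreeing with `y` at `σ i` and with `y'` elsewhere is sent by
`Φ` to the point agreeing with `Φ y` at `i` and with `Φ y'` elsewhere. Applying `Ψ` recovers the
former, whose `σ i` coordinate is that of `y`. -/
theorem dependsOnAE_inverse (hΦ : MeasurePreserving Φ (Measure.pi ν) (Measure.pi μ))
    (hΨ : MeasurePreserving Ψ (Measure.pi μ) (Measure.pi ν))
    (hΨΦ : ∀ᵐ y ∂Measure.pi ν, Ψ (Φ y) = y) (σ : Equiv.Perm (Fin d))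
    (h : ∀ i, DependsOnAE ν {σ i} fun y => Φ y i) (i : Fin d) :
    DependsOnAE μ {i} fun x => Ψ x (σ i) := by
  refine ae_of_ae_comp (hΦ.prod hΦ)
    (measurableSet_resample ((measurable_pi_apply _).comp hΨ.measurable) _) ?_
  have h1 : ∀ k, k ≠ i → ∀ᵐ p ∂((Measure.pi ν).prod (Measure.pi ν)),
      Φ (({σ i} : Finset (Fin d)).piecewise p.1 p.2) k = Φ p.2 k := by
    intro k hk
    have := ((h k).mono (B := {σ i}ᶜ) ((measurable_pi_apply k).comp hΦ.measurable)
      (by simpa using fun e => hk (σ.injective e).symm)).compl_swap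
    simp only [Finset.piecewise_compl] at this ⊢
    simpa [compl_compl, Finset.piecewise_compl] using this
  have h1' : ∀ᵐ p ∂((Measure.pi ν).prod (Measure.pi ν)), ∀ k, k ≠ i →
      Φ (({σ i} : Finset (Fin d)).piecewise p.1 p.2) k = Φ p.2 k := by
    rw [ae_all_iff]; intro k
    by_cases hk : k = i
    · simp [hk]
    · filter_upwards [h1 k hk] with p hp _ using hp
  filter_upwards [h1', h i,
    (measurePreserving_piecewise ν {σ i}).quasiMeasurePreserving.ae hΨΦ,
    measurePreserving_fst.quasiMeasurePreserving.ae hΨΦ] with p h2 h3 h4 h5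
  have h6 : Φ (({σ i} : Finset (Fin d)).piecewise p.1 p.2) =
      ({i} : Finset (Fin d)).piecewise (Φ p.1) (Φ p.2) := by
    ext k
    by_cases hk : k = i
    · subst hk; simpa using h3
    · simpa [Finset.piecewise, hk] using h2 k hk
  simp only [Prod.map]
  rw [← h6, h4, h5]
  simp

theorem restrictsToCoordinates_of_dependsOnAE {S : ∀ i, ℝ → Y i → Y i} {T : ∀ i, ℝ → X i → X i}
    (hS : ∀ i t, MeasurePreserving (S i t) (ν i) (ν i)) (hT : ∀ i t, Measurable (T i t))
    (hΦ : MeasurePreserving Φ (Measure.pi ν) (Measure.pi μ))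
    (hΨ : MeasurePreserving Ψ (Measure.pi μ) (Measure.pi ν))
    (hΨΦ : ∀ᵐ y ∂Measure.pi ν, Ψ (Φ y) = y)
    (hint : ∀ t, ∀ᵐ y ∂(Measure.pi ν), Φ (pi S t y) = pi T t (Φ y)) (σ : Equiv.Perm (Fin d))
    (h : ∀ i, DependsOnAE ν {σ i} fun y => Φ y i) :
    RestrictsToCoordinates S ν T μ Φ σ := by
  intro i
  obtain ⟨φ, hφ, hφΦ⟩ := (h i).exists_factor ((measurable_pi_apply i).comp hΦ.measurable)
  obtain ⟨ψ, hψ, hψΨ⟩ := (dependsOnAE_inverse hΦ hΨ hΨΦ σ h i).exists_factor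
    ((measurable_pi_apply (σ i)).comp hΨ.measurable)
  have hev := measurePreserving_eval ν (σ i)
  have hφν : MeasurePreserving φ (ν (σ i)) (μ i) := by
    refine ⟨hφ, ?_⟩
    rw [← hev.map_eq, Measure.map_map hφ hev.measurable,
      ← ((measurePreserving_eval μ i).comp hΦ).map_eq]
    exact Measure.map_congr (hφΦ.mono fun y hy => hy.symm)
  have hψφ : ∀ᵐ z ∂(ν (σ i)), ψ (φ z) = z := by
    refine ae_of_ae_comp hev (measurableSet_eq_fun (hψ.comp hφ) measurable_id) ?_
    filter_upwards [hφΦ, hΦ.quasiMeasurePreserving.ae hψΨ, hΨΦ] with y h1 h2 h3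
    simp only [Function.eval, Function.comp] at *
    rw [← h1, ← h2, h3]
  refine ⟨φ, ⟨hφν, ⟨ψ, ⟨hψ, ?_⟩, hψφ, ?_⟩, fun t => ?_⟩, hφΦ⟩
  · rw [← hφν.map_eq, Measure.map_map hψ hφ]
    exact (Measure.map_congr hψφ).trans Measure.map_id
  · refine ae_of_ae_comp hφν (measurableSet_eq_fun (hφ.comp hψ) measurable_id) ?_
    filter_upwards [hψφ] with z hz
    rw [hz]
  · refine ae_of_ae_comp hev (measurableSet_eq_fun (hφ.comp (hS _ t).measurable)
      ((hT i t).comp hφ)) ?_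
    have hSpi : MeasurePreserving (pi S t) (Measure.pi ν) (Measure.pi ν) :=
      measurePreserving_pi ν ν fun i => hS i t
    filter_upwards [hφΦ, hSpi.quasiMeasurePreserving.ae hφΦ, hint t] with y h1 h2 h3
    simp only [Function.eval, Function.comp] at *
    rw [← h1, show φ (S (σ i) t (y (σ i))) = φ (pi S t y (σ i)) from rfl, ← h2, h3]
    rfl

end Coordinates

/-! ### Convergence of couplings, along a filter or in Cesàro mean, from a π-system. -/

section Couplings

/-- A class of real functions that are null in some sense, closed under dominated sums. -/
structure IsNullClass {𝕋 : Type*} (G : (𝕋 → ℝ) → Prop) : Prop where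
  zero : G fun _ => 0
  neg : ∀ φ, G φ → G fun t => -φ t
  tsum : ∀ (φ : ℕ → 𝕋 → ℝ) (a : ℕ → ℝ), Summable a → (∀ n t, |φ n t| ≤ a n) → (∀ n, G (φ n)) →
    G fun t => ∑' n, φ n t

theorem isNullClass_tendsto {𝕋 : Type*} (l : Filter 𝕋) :
    IsNullClass fun φ : 𝕋 → ℝ => Tendsto φ l (𝓝 0) where
  zero := tendsto_const_nhds
  neg φ h := by simpa using h.neg
  tsum φ a ha hb h := by
    simpa using tendsto_tsum_of_dominated_convergence ha h (Eventually.of_forall fun t n => hb n t)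

/-- A continuous function whose absolute value has Cesàro averages tending to `0`. -/
def CesaroNull (φ : ℝ → ℝ) : Prop :=
  Continuous φ ∧ Tendsto (fun R : ℝ => R⁻¹ * ∫ t in (0 : ℝ)..R, |φ t|) atTop (𝓝 0)

theorem CesaroNull.of_abs_le {φ ψ : ℝ → ℝ} (hψ : CesaroNull ψ) (hφ : Continuous φ)
    (h : ∀ t, |φ t| ≤ |ψ t|) : CesaroNull φ := by
  refine ⟨hφ, squeeze_zero' ?_ ?_ hψ.2⟩
  · filter_upwards [eventually_ge_atTop 0] with R hR
    exact mul_nonneg (inv_nonneg.2 hR) (intervalIntegral.integral_nonneg hR fun t _ => abs_nonneg _)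
  · filter_upwards [eventually_ge_atTop 0] with R hR
    refine mul_le_mul_of_nonneg_left ?_ (inv_nonneg.2 hR)
    exact intervalIntegral.integral_mono_on hR (hφ.abs.intervalIntegrable _ _)
      (hψ.1.abs.intervalIntegrable _ _) fun t _ => h t

theorem CesaroNull.add {φ ψ : ℝ → ℝ} (hφ : CesaroNull φ) (hψ : CesaroNull ψ) :
    CesaroNull fun t => φ t + ψ t := by
  have h0 : CesaroNull fun t => |φ t| + |ψ t| := by
    refine ⟨hφ.1.abs.add hψ.1.abs, ?_⟩
    have := hφ.2.add hψ.2
    simp only [add_zero] at this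
    refine this.congr fun R => ?_
    rw [← mul_add, ← intervalIntegral.integral_add (hφ.1.abs.intervalIntegrable _ _)
      (hψ.1.abs.intervalIntegrable _ _)]
    congr 2
    ext t
    rw [abs_of_nonneg (add_nonneg (abs_nonneg (φ t)) (abs_nonneg (ψ t)))]
  refine h0.of_abs_le (hφ.1.add hψ.1) fun t => (abs_add_le _ _).trans (le_abs_self _)

theorem cesaroNull_zero : CesaroNull fun _ => 0 := ⟨continuous_const, by simp⟩

theorem cesaroNull_sum {φ : ℕ → ℝ → ℝ} (h : ∀ n, CesaroNull (φ n)) (N : ℕ) :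
    CesaroNull fun t => ∑ n ∈ Finset.range N, φ n t := by
  induction N with
  | zero => simpa using cesaroNull_zero
  | succ N ih => simpa [Finset.sum_range_succ] using ih.add (h N)

/-- The tail of the dominating series is below `ε / 2` uniformly in `t`; the remaining finite sum is
Cesàro null. -/
theorem isNullClass_cesaroNull : IsNullClass CesaroNull where
  zero := cesaroNull_zero
  neg φ h := h.of_abs_le h.1.neg fun t => (abs_neg _).le
  tsum φ a ha hb h := by
    have hc : Continuous fun t => ∑' n, φ n t := continuous_tsum (fun n => (h n).1) ha hb
    refine ⟨hc, Metric.tendsto_nhds.2 fun ε hε => ?_⟩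
    obtain ⟨N, hN⟩ := ((tendsto_sum_nat_add a).eventually (gt_mem_nhds (half_pos hε))).exists
    have hsum := cesaroNull_sum h N
    have hle : ∀ t, |∑' n, φ n t| ≤ |∑ n ∈ Finset.range N, φ n t| + ε / 2 := by
      intro t
      have hs : Summable fun n => φ n t := ha.of_norm_bounded fun n => hb n t
      rw [← hs.sum_add_tsum_nat_add N]
      refine (abs_add_le _ _).trans (add_le_add le_rfl ?_)
      refine le_trans ?_ hN.le
      exact tsum_of_norm_bounded ((summable_nat_add_iff N).2 ha).hasSum fun n =>
        (Real.norm_eq_abs _).trans_le (hb (n + N) t)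
    filter_upwards [eventually_gt_atTop 0,
      hsum.2.eventually (gt_mem_nhds (half_pos hε))] with R hR hlt
    rw [Real.dist_0_eq_abs, abs_of_nonneg (mul_nonneg (inv_nonneg.2 hR.le)
      (intervalIntegral.integral_nonneg hR.le fun t _ => abs_nonneg _))]
    have h1 : ∫ t in (0 : ℝ)..R, |∑' n, φ n t| ≤
        ∫ t in (0 : ℝ)..R, (|∑ n ∈ Finset.range N, φ n t| + ε / 2) :=
      intervalIntegral.integral_mono_on hR.le (hc.abs.intervalIntegrable _ _)
        ((hsum.1.abs.add continuous_const).intervalIntegrable _ _) fun t _ => hle t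
    rw [intervalIntegral.integral_add (hsum.1.abs.intervalIntegrable _ _)
      (continuous_const.intervalIntegrable _ _), intervalIntegral.integral_const] at h1
    have h2 := mul_le_mul_of_nonneg_left h1 (inv_nonneg.2 hR.le)
    rw [mul_add, sub_zero, smul_eq_mul, inv_mul_cancel_left₀ hR.ne'] at h2
    linarith

variable {Ω : Type*} [mΩ : MeasurableSpace Ω]

theorem hasSum_real_iUnion (m : Measure Ω) [IsFiniteMeasure m] {f : ℕ → Set Ω}
    (hd : Pairwise (Function.onFun Disjoint f)) (hf : ∀ i, MeasurableSet (f i)) :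
    HasSum (fun n => m.real (f n)) (m.real (⋃ n, f n)) := by
  have h := measure_iUnion (μ := m) hd hf
  have h' := ENNReal.hasSum_toReal (h ▸ measure_ne_top m (⋃ n, f n))
  rwa [← ENNReal.tsum_toReal_eq fun n => measure_ne_top m (f n), ← h] at h'

/-- A Dynkin argument: equal total masses handle complements, and domination by the fixed finite `μ`
supplies the summable bound for disjoint unions. -/
theorem IsNullClass.of_piSystem {𝕋 : Type*} {G : (𝕋 → ℝ) → Prop} (hG : IsNullClass G)
    {μ : Measure Ω} [IsFiniteMeasure μ] {ρ : 𝕋 → Measure Ω} {ρ₀ : Measure Ω}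
    (hρ : ∀ t A, MeasurableSet A → ρ t A ≤ μ A) (hρ₀ : ∀ A, MeasurableSet A → ρ₀ A ≤ μ A)
    (huniv : ∀ t, ρ t Set.univ = ρ₀ Set.univ) {C : Set (Set Ω)}
    (hC : mΩ = MeasurableSpace.generateFrom C) (hpi : IsPiSystem C)
    (h : ∀ A ∈ C, G fun t => (ρ t).real A - ρ₀.real A) {A : Set Ω} (hA : MeasurableSet A) :
    G fun t => (ρ t).real A - ρ₀.real A := by
  have hfin : ∀ t, IsFiniteMeasure (ρ t) := fun t =>
    ⟨(hρ t _ MeasurableSet.univ).trans_lt (measure_lt_top μ _)⟩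
  have hfin₀ : IsFiniteMeasure ρ₀ := ⟨(hρ₀ _ MeasurableSet.univ).trans_lt (measure_lt_top μ _)⟩
  have hr : ∀ t A, MeasurableSet A → (ρ t).real A ≤ μ.real A := fun t A hA =>
    ENNReal.toReal_mono (measure_ne_top μ A) (hρ t A hA)
  have hr₀ : ∀ A, MeasurableSet A → ρ₀.real A ≤ μ.real A := fun A hA =>
    ENNReal.toReal_mono (measure_ne_top μ A) (hρ₀ A hA)
  induction A, hA using MeasurableSpace.induction_on_inter hC hpi with
  | empty => simpa using hG.zero
  | basic A hA => exact h A hA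
  | compl A hA ih =>
    convert hG.neg _ ih using 2 with t
    rw [measureReal_compl hA, measureReal_compl hA,
      show (ρ t).real Set.univ = ρ₀.real Set.univ from congrArg ENNReal.toReal (huniv t)]
    ring
  | iUnion f hd hf ih =>
    have := hG.tsum _ (fun n => μ.real (f n)) (hasSum_real_iUnion μ hd hf).summable
      (fun n t => ?_) ih
    · convert this using 2 with t
      exact ((hasSum_real_iUnion (ρ t) hd hf).sub (hasSum_real_iUnion ρ₀ hd hf)).tsum_eq.symm
    · have h1 := hr t _ (hf n)
      have h2 := hr₀ _ (hf n)
      have h3 : 0 ≤ (ρ t).real (f n) := measureReal_nonneg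
      have h4 : 0 ≤ ρ₀.real (f n) := measureReal_nonneg
      rw [abs_le]; constructor <;> linarith

/-- `ρ` is a coupling of `μ` with itself. -/
structure IsSelfCoupling (μ : Measure Ω) (ρ : Measure (Ω × Ω)) : Prop where
  map_fst : ρ.map Prod.fst = μ
  map_snd : ρ.map Prod.snd = μ

theorem IsSelfCoupling.prod_univ {μ : Measure Ω} {ρ : Measure (Ω × Ω)} (h : IsSelfCoupling μ ρ)
    {A : Set Ω} (hA : MeasurableSet A) : ρ (A ×ˢ Set.univ) = μ A := by
  rw [← h.map_fst, Measure.map_apply measurable_fst hA, Set.prod_univ]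

theorem IsSelfCoupling.univ_prod {μ : Measure Ω} {ρ : Measure (Ω × Ω)} (h : IsSelfCoupling μ ρ)
    {A : Set Ω} (hA : MeasurableSet A) : ρ (Set.univ ×ˢ A) = μ A := by
  rw [← h.map_snd, Measure.map_apply measurable_snd hA, Set.univ_prod]

/-- Two applications of `of_piSystem`, one side of the rectangle at a time. Restricting a coupling
to a strip and projecting gives a measure dominated by the marginal, with total mass the same for
all couplings. -/
theorem IsNullClass.of_piSystem_prod {𝕋 : Type*} {G : (𝕋 → ℝ) → Prop} (hG : IsNullClass G)
    {μ : Measure Ω} [IsFiniteMeasure μ] {ρ : 𝕋 → Measure (Ω × Ω)} {ρ₀ : Measure (Ω × Ω)}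
    (hρ : ∀ t, IsSelfCoupling μ (ρ t)) (hρ₀ : IsSelfCoupling μ ρ₀) {C : Set (Set Ω)}
    (hC : mΩ = MeasurableSpace.generateFrom C) (hpi : IsPiSystem C)
    (h : ∀ A ∈ C, ∀ B ∈ C, G fun t => (ρ t).real (A ×ˢ B) - ρ₀.real (A ×ˢ B))
    {A B : Set Ω} (hA : MeasurableSet A) (hB : MeasurableSet B) :
    G fun t => (ρ t).real (A ×ˢ B) - ρ₀.real (A ×ˢ B) := by
  have hR : ∀ (r : Measure (Ω × Ω)) (A B : Set Ω), MeasurableSet A → MeasurableSet B →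
      (r.restrict (A ×ˢ Set.univ)).map Prod.snd B = r (A ×ˢ B) := by
    intro r A B hA hB
    rw [Measure.map_apply measurable_snd hB, Measure.restrict_apply (measurable_snd hB)]
    congr 1; ext p; simp [and_comm]
  have hL : ∀ (r : Measure (Ω × Ω)) (A B : Set Ω), MeasurableSet A → MeasurableSet B →
      (r.restrict (Set.univ ×ˢ B)).map Prod.fst A = r (A ×ˢ B) := by
    intro r A B hA hB
    rw [Measure.map_apply measurable_fst hA, Measure.restrict_apply (measurable_fst hA)]
    congr 1; ext p; simp
  have hCm : ∀ A ∈ C, MeasurableSet A := fun A hA => by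
    rw [hC]; exact MeasurableSpace.measurableSet_generateFrom hA
  have step : ∀ A ∈ C, G fun t => (ρ t).real (A ×ˢ B) - ρ₀.real (A ×ˢ B) := by
    intro A hA
    have hA' := hCm A hA
    have := hG.of_piSystem (μ := μ) (ρ := fun t => ((ρ t).restrict (A ×ˢ Set.univ)).map Prod.snd)
      (ρ₀ := (ρ₀.restrict (A ×ˢ Set.univ)).map Prod.snd)
      (fun t B hB => ?_) (fun B hB => ?_) (fun t => ?_) hC hpi (fun B hB => ?_) hB
    · simpa only [Measure.real, hR _ A B hA' hB] using this
    · rw [hR _ A B hA' hB, ← (hρ t).univ_prod hB]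
      exact measure_mono (Set.prod_mono (Set.subset_univ _) le_rfl)
    · rw [hR _ A B hA' hB, ← hρ₀.univ_prod hB]
      exact measure_mono (Set.prod_mono (Set.subset_univ _) le_rfl)
    · rw [hR _ A _ hA' .univ, hR _ A _ hA' .univ, (hρ t).prod_univ hA', hρ₀.prod_univ hA']
    · simpa only [Measure.real, hR _ A B hA' (hCm B hB)] using h A hA B hB
  have := hG.of_piSystem (μ := μ) (ρ := fun t => ((ρ t).restrict (Set.univ ×ˢ B)).map Prod.fst)
    (ρ₀ := (ρ₀.restrict (Set.univ ×ˢ B)).map Prod.fst)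
    (fun t A hA => ?_) (fun A hA => ?_) (fun t => ?_) hC hpi (fun A hA => ?_) hA
  · simpa only [Measure.real, hL _ A B hA hB] using this
  · rw [hL _ A B hA hB, ← (hρ t).prod_univ hA]
    exact measure_mono (Set.prod_mono le_rfl (Set.subset_univ _))
  · rw [hL _ A B hA hB, ← hρ₀.prod_univ hA]
    exact measure_mono (Set.prod_mono le_rfl (Set.subset_univ _))
  · rw [hL _ _ B .univ hB, hL _ _ B .univ hB, (hρ t).univ_prod hB, hρ₀.univ_prod hB]
  · simpa only [Measure.real, hL _ A B (hCm A hA) hB] using step A hA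

theorem isSelfCoupling_graph {μ : Measure Ω} {T : Ω → Ω} (hT : MeasurePreserving T μ μ) :
    IsSelfCoupling μ (μ.map fun x => (x, T x)) where
  map_fst := by
    rw [Measure.map_map measurable_fst (measurable_id'.prodMk hT.measurable)]
    exact Measure.map_id'
  map_snd := by
    rw [Measure.map_map measurable_snd (measurable_id'.prodMk hT.measurable)]
    exact hT.map_eq

theorem isSelfCoupling_prod (μ : Measure Ω) [IsProbabilityMeasure μ] :
    IsSelfCoupling μ (μ.prod μ) where
  map_fst := by simp
  map_snd := by simp

/-- Correlations are thus masses of rectangles under the graph coupling, so mixing properties become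
convergence of couplings. -/
theorem graph_real_prod {μ : Measure Ω} {T : Ω → Ω} (hT : Measurable T) {A B : Set Ω}
    (hA : MeasurableSet A) (hB : MeasurableSet B) :
    (μ.map fun x => (x, T x)).real (A ×ˢ B) = μ.real (A ∩ T ⁻¹' B) := by
  rw [Measure.real, Measure.map_apply (measurable_id'.prodMk hT) (hA.prod hB)]
  rfl

end Couplings

/-! ### Continuity, weak mixing, ergodicity and factors of flows. -/

section Flows

variable {X Y : Type*} [mX : MeasurableSpace X] [MeasurableSpace Y] {μ : Measure X} {ν : Measure Y}
  [IsProbabilityMeasure μ] [IsProbabilityMeasure ν] {T : ℝ → X → X} {S : ℝ → Y → Y}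

theorem integral_indicator_comp_mul {X : Type*} [MeasurableSpace X] {μ : Measure X} {τ : X → X} (hτ : MeasurePreserving τ μ μ) {A B : Set X}
    (hA : MeasurableSet A) (hB : MeasurableSet B) :
    ∫ x, B.indicator (fun _ => (1 : ℂ)) (τ x) * starRingEnd ℂ (A.indicator (fun _ => (1 : ℂ)) x) ∂μ
      = (μ.real (A ∩ τ ⁻¹' B) : ℂ) := by
  rw [← integral_indicator_one (hA.inter (hτ.measurable hB)), ← integral_complex_ofReal]
  congr 1
  ext x
  by_cases h1 : x ∈ A <;> by_cases h2 : τ x ∈ B <;> simp [Set.indicator, h1, h2]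

theorem memLp_indicator_one (μ : Measure X) [IsFiniteMeasure μ] {A : Set X}
    (hA : MeasurableSet A) : MemLp (A.indicator fun _ => (1 : ℂ)) 2 μ :=
  (memLp_const 1).indicator hA

theorem IsMeasurableFlow.continuous_real_inter (hT : IsMeasurableFlow T μ) {A B : Set X}
    (hA : MeasurableSet A) (hB : MeasurableSet B) :
    Continuous fun t => μ.real (A ∩ T t ⁻¹' B) := by
  have := hT.continuous_inner _ _ (memLp_indicator_one μ hB) (memLp_indicator_one μ hA)
  simp only [integral_indicator_comp_mul (hT.measurePreserving _) hA hB] at this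
  exact Complex.continuous_re.comp this

/-- Composition with `T t` is an `L²` isometry, so approximating `f` or `g` in `L²` approximates the
correlation uniformly in `t`. Continuity therefore passes from indicators to all of `L²`. -/
theorem isMeasurableFlow_of_continuous_real_inter (h0 : ∀ x, T 0 x = x)
    (hadd : ∀ s t x, T (s + t) x = T s (T t x)) (hmp : ∀ t, MeasurePreserving (T t) μ μ)
    (hc : ∀ A B, MeasurableSet A → MeasurableSet B → Continuous fun t => μ.real (A ∩ T t ⁻¹' B)) :
    IsMeasurableFlow T μ where
  map_zero := h0
  map_add := hadd
  measurePreserving := hmp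
  continuous_inner := by
    have key : ∀ f g : Lp ℂ 2 μ,
        Continuous fun t => inner ℂ g (Lp.compMeasurePreserving (T t) (hmp t) f) := by
      have hclosed : ∀ g : Lp ℂ 2 μ, IsClosed {f : Lp ℂ 2 μ |
          Continuous fun t => inner ℂ g (Lp.compMeasurePreserving (T t) (hmp t) f)} := by
        intro g
        refine isClosed_of_closure_subset fun f hf => ?_
        obtain ⟨u, hu, hlim⟩ := mem_closure_iff_seq_limit.1 hf
        refine TendstoUniformly.continuous (p := atTop)
          (F := fun n t => inner ℂ g (Lp.compMeasurePreserving (T t) (hmp t) (u n))) ?_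
          (Eventually.of_forall hu).frequently
        rw [Metric.tendstoUniformly_iff]
        intro ε hε
        have h1 : Tendsto (fun n => ‖g‖ * ‖f - u n‖) atTop (𝓝 0) := by
          simpa using (tendsto_const_nhds (x := f)).sub hlim |>.norm.const_mul ‖g‖
        filter_upwards [h1.eventually (gt_mem_nhds hε)] with n hn t
        rw [dist_eq_norm, ← inner_sub_right, ← map_sub]
        refine lt_of_le_of_lt (norm_inner_le_norm _ _) ?_
        rwa [Lp.norm_compMeasurePreserving]
      have hclosed' : ∀ f : Lp ℂ 2 μ, IsClosed {g : Lp ℂ 2 μ |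
          Continuous fun t => inner ℂ g (Lp.compMeasurePreserving (T t) (hmp t) f)} := by
        intro f
        refine isClosed_of_closure_subset fun g hg => ?_
        obtain ⟨u, hu, hlim⟩ := mem_closure_iff_seq_limit.1 hg
        refine TendstoUniformly.continuous (p := atTop)
          (F := fun n t => inner ℂ (u n) (Lp.compMeasurePreserving (T t) (hmp t) f)) ?_
          (Eventually.of_forall hu).frequently
        rw [Metric.tendstoUniformly_iff]
        intro ε hε
        have h1 : Tendsto (fun n => ‖g - u n‖ * ‖f‖) atTop (𝓝 0) := by
          simpa using ((tendsto_const_nhds (x := g)).sub hlim |>.norm.mul_const ‖f‖)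
        filter_upwards [h1.eventually (gt_mem_nhds hε)] with n hn t
        rw [dist_eq_norm, ← inner_sub_left]
        refine lt_of_le_of_lt (norm_inner_le_norm _ _) ?_
        rwa [Lp.norm_compMeasurePreserving]
      intro f g
      induction f using Lp.induction (p := 2) (by simp) with
      | indicatorConst b hB hBμ =>
        induction g using Lp.induction (p := 2) (by simp) with
        | indicatorConst a hA hAμ =>
          simp only [Lp.simpleFunc.coe_indicatorConst, Lp.indicatorConstLp_compMeasurePreserving,
            L2.inner_indicatorConstLp_indicatorConstLp]
          exact (hc _ _ hA hB).smul continuous_const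
        | add hf hg _ h1 h2 => simpa only [inner_add_left] using Continuous.fun_add h1 h2
        | isClosed => exact hclosed' _
      | add hf hg _ h1 h2 => simpa only [map_add, inner_add_right] using Continuous.fun_add h1 h2
      | isClosed => exact hclosed g
    intro f g hf hg
    convert key (hf.toLp f) (hg.toLp g) using 2 with t
    rw [L2.inner_def]
    refine integral_congr_ae ?_
    filter_upwards [Lp.coeFn_compMeasurePreserving (hf.toLp f) (hmp t), hg.coeFn_toLp,
      (hmp t).quasiMeasurePreserving.ae hf.coeFn_toLp] with x h1 h2 h3
    rw [h1, h2, Function.comp, h3]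
    simp

theorem isWeaklyMixing_iff_cesaroNull (hT : IsMeasurableFlow T μ) :
    IsWeaklyMixing T μ ↔ ∀ A B, MeasurableSet A → MeasurableSet B →
      CesaroNull fun t => μ.real (A ∩ T t ⁻¹' B) - μ.real A * μ.real B :=
  ⟨fun h A B hA hB => ⟨(hT.continuous_real_inter hA hB).sub continuous_const, h A B hA hB⟩,
    fun h A B hA hB => (h A B hA hB).2⟩

theorem isWeaklyMixing_of_piSystem (hT : ∀ t, MeasurePreserving (T t) μ μ) {C : Set (Set X)}
    (hC : mX = MeasurableSpace.generateFrom C) (hpi : IsPiSystem C)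
    (h : ∀ A ∈ C, ∀ B ∈ C, CesaroNull fun t => μ.real (A ∩ T t ⁻¹' B) - μ.real A * μ.real B) :
    IsWeaklyMixing T μ := by
  intro A B hA hB
  have hCm : ∀ A ∈ C, MeasurableSet A := fun A hA => by
    rw [hC]; exact MeasurableSpace.measurableSet_generateFrom hA
  have hg := fun t => @graph_real_prod X _ μ (T t) (hT t).measurable
  have := isNullClass_cesaroNull.of_piSystem_prod (fun t => isSelfCoupling_graph (hT t))
    (isSelfCoupling_prod μ) hC hpi (fun A hA B hB => ?_) hA hB
  · simpa only [hg _ hA hB, measureReal_prod_prod] using this.2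
  · simpa only [hg _ (hCm A hA) (hCm B hB), measureReal_prod_prod] using h A hA B hB

theorem CesaroNull.mul_sub {a b : ℝ → ℝ} {a₀ b₀ : ℝ} (ha : CesaroNull fun t => a t - a₀)
    (hb : CesaroNull fun t => b t - b₀) (ha1 : |a₀| ≤ 1) (hb1 : ∀ t, |b t| ≤ 1) :
    CesaroNull fun t => a t * b t - a₀ * b₀ := by
  have hac : Continuous a := by
    simpa using ha.1.fun_add (continuous_const (y := a₀))
  have hbc : Continuous b := by
    simpa using hb.1.fun_add (continuous_const (y := b₀))
  have h1 : CesaroNull fun t => (a t - a₀) * b t := by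
    refine ha.of_abs_le (ha.1.mul hbc) fun t => ?_
    rw [abs_mul]
    exact mul_le_of_le_one_right (abs_nonneg _) (hb1 t)
  have h2 : CesaroNull fun t => a₀ * (b t - b₀) := by
    refine hb.of_abs_le (continuous_const.mul hb.1) fun t => ?_
    rw [abs_mul]
    exact mul_le_of_le_one_left (abs_nonneg _) ha1
  convert h1.add h2 using 2 with t
  ring

theorem cesaroNull_prod {ι : Type*} (s : Finset ι) {a : ι → ℝ → ℝ} {a₀ : ι → ℝ}
    (h : ∀ i, CesaroNull fun t => a i t - a₀ i) (ha0 : ∀ i, |a₀ i| ≤ 1) (ha : ∀ i t, |a i t| ≤ 1) :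
    CesaroNull fun t => ∏ i ∈ s, a i t - ∏ i ∈ s, a₀ i := by
  classical
  induction s using Finset.induction_on with
  | empty => simpa using cesaroNull_zero
  | insert i s hi ih =>
    simp only [Finset.prod_insert hi]
    refine (h i).mul_sub ih (ha0 i) fun t => ?_
    rw [Finset.abs_prod]
    exact Finset.prod_le_one (fun i _ => abs_nonneg _) fun i _ => ha i t

theorem abs_measureReal_le_one (μ : Measure X) [IsProbabilityMeasure μ] (A : Set X) :
    |μ.real A| ≤ 1 := by
  rw [abs_of_nonneg measureReal_nonneg]; exact measureReal_le_one

theorem IsWeaklyMixing.prod (hT : IsMeasurableFlow T μ) (hS : IsMeasurableFlow S ν)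
    (hTw : IsWeaklyMixing T μ) (hSw : IsWeaklyMixing S ν) :
    IsWeaklyMixing (MeasFlow.prod T S) (μ.prod ν) := by
  rw [isWeaklyMixing_iff_cesaroNull hT] at hTw
  rw [isWeaklyMixing_iff_cesaroNull hS] at hSw
  refine isWeaklyMixing_of_piSystem
    (fun t => (hT.measurePreserving t).prod (hS.measurePreserving t))
    generateFrom_prod.symm isPiSystem_prod ?_
  rintro _ ⟨A, hA, A', hA', rfl⟩ _ ⟨B, hB, B', hB', rfl⟩
  have := (hTw A B hA hB).mul_sub (hSw A' B' hA' hB') ?_ fun t => abs_measureReal_le_one _ _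
  · convert this using 2 with t
    have hset : A ×ˢ A' ∩ MeasFlow.prod T S t ⁻¹' B ×ˢ B' =
        (A ∩ T t ⁻¹' B) ×ˢ (A' ∩ S t ⁻¹' B') := by
      ext p; simp [MeasFlow.prod]; tauto
    rw [hset, measureReal_prod_prod, measureReal_prod_prod, measureReal_prod_prod]
    ring
  · rw [abs_mul]
    exact mul_le_one₀ (abs_measureReal_le_one _ _) (abs_nonneg _) (abs_measureReal_le_one _ _)

theorem IsWeaklyMixing.isErgodic (h : IsWeaklyMixing T μ) : IsErgodic T μ := by
  intro A hA hinv
  -- On an invariant set the correlation is constant in time, so its Cesàro limit forces `μ A = (μ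
  -- A)²`.
  have h1 : ∀ t, μ.real (A ∩ T t ⁻¹' A) = μ.real A := fun t => by
    refine measureReal_congr ?_
    have := (ae_eq_refl A).inter (hinv t)
    simpa using this
  have h2 := h A A hA hA
  simp only [h1, intervalIntegral.integral_const, sub_zero, smul_eq_mul] at h2
  have h3 : |μ.real A - μ.real A * μ.real A| = 0 := by
    refine tendsto_nhds_unique (f := fun _ : ℝ => |μ.real A - μ.real A * μ.real A|)
      tendsto_const_nhds (h2.congr' ?_)
    filter_upwards [eventually_ne_atTop 0] with R hR
    rw [inv_mul_cancel_left₀ hR]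
  rw [abs_eq_zero, ← mul_one_sub, mul_eq_zero] at h3
  rcases h3 with h3 | h3
  · exact Or.inl (by simpa [Measure.real, ENNReal.toReal_eq_zero_iff] using h3)
  · right
    have : μ.real Aᶜ = 0 := by rw [measureReal_compl hA]; simpa using h3
    simpa [Measure.real, ENNReal.toReal_eq_zero_iff] using this

theorem measureReal_inter_factor {X Y : Type*} [MeasurableSpace X] [MeasurableSpace Y]
    {μ : Measure X} {ν : Measure Y} {τ : X → X} {σ : Y → Y} {p : X → Y}
    (hp : MeasurePreserving p μ ν) (hσ : Measurable σ) (hint : ∀ᵐ x ∂μ, p (τ x) = σ (p x))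
    {A B : Set Y} (hA : MeasurableSet A) (hB : MeasurableSet B) :
    μ.real (p ⁻¹' A ∩ τ ⁻¹' (p ⁻¹' B)) = ν.real (A ∩ σ ⁻¹' B) := by
  rw [← hp.measureReal_preimage (hA.inter (hσ hB)).nullMeasurableSet]
  refine measureReal_congr ?_
  rw [Set.preimage_inter]
  refine (ae_eq_refl _).inter ?_
  filter_upwards [hint] with x hx
  refine propext ?_
  change p (τ x) ∈ B ↔ σ (p x) ∈ B
  rw [hx]

/-- Weak mixing passes to factors. -/
theorem IsWeaklyMixing.factor {X Y : Type*} [MeasurableSpace X] [MeasurableSpace Y]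
    {μ : Measure X} {ν : Measure Y} {T : ℝ → X → X} {S : ℝ → Y → Y}
    (h : IsWeaklyMixing T μ) {p : X → Y} (hp : MeasurePreserving p μ ν)
    (hS : ∀ t, Measurable (S t)) (hint : ∀ t, ∀ᵐ x ∂μ, p (T t x) = S t (p x)) :
    IsWeaklyMixing S ν := by
  intro A B hA hB
  have h1 := h (p ⁻¹' A) (p ⁻¹' B) (hp.measurable hA) (hp.measurable hB)
  simpa only [measureReal_inter_factor hp (hS _) (hint _) hA hB,
    hp.measureReal_preimage hA.nullMeasurableSet,
    hp.measureReal_preimage hB.nullMeasurableSet] using h1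

theorem IsErgodic.factor {X Y : Type*} [MeasurableSpace X] [MeasurableSpace Y]
    {μ : Measure X} {ν : Measure Y} {T : ℝ → X → X} {S : ℝ → Y → Y}
    (h : IsErgodic T μ) {p : X → Y} (hp : MeasurePreserving p μ ν)
    (hint : ∀ t, ∀ᵐ x ∂μ, p (T t x) = S t (p x)) :
    IsErgodic S ν := by
  intro A hA hinv
  have := h (p ⁻¹' A) (hp.measurable hA) fun t => by
    refine EventuallyEq.trans ?_ (hp.quasiMeasurePreserving.preimage_ae_eq (hinv t))
    filter_upwards [hint t] with x hx
    refine propext ?_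
    change p (T t x) ∈ A ↔ S t (p x) ∈ A
    rw [hx]
  rwa [← Set.preimage_compl, hp.measure_preimage hA.nullMeasurableSet,
    hp.measure_preimage hA.compl.nullMeasurableSet] at this

theorem intertwines_inverse {X Y : Type*} [MeasurableSpace X] [MeasurableSpace Y]
    {μ : Measure X} {ν : Measure Y} {T : ℝ → X → X} {S : ℝ → Y → Y} {Φ : Y → X} {Ψ : X → Y}
    (hΨ : MeasurePreserving Ψ μ ν) (hS : ∀ t, MeasurePreserving (S t) ν ν)
    (hΨΦ : ∀ᵐ y ∂ν, Ψ (Φ y) = y) (hΦΨ : ∀ᵐ x ∂μ, Φ (Ψ x) = x)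
    (hint : ∀ t, ∀ᵐ y ∂ν, Φ (S t y) = T t (Φ y)) (t : ℝ) :
    ∀ᵐ x ∂μ, Ψ (T t x) = S t (Ψ x) := by
  filter_upwards [hΨ.quasiMeasurePreserving.ae (hint t), hΦΨ,
    ((hS t).comp hΨ).quasiMeasurePreserving.ae hΨΦ] with x h1 h2 h3
  simp only [Function.comp] at h3
  rw [← h3, h1, h2]

end Flows

/-! ### Finite products of flows. -/

section PiFlows

variable {ι : Type*} [Fintype ι] {X : ι → Type*} [∀ i, MeasurableSpace (X i)]
  {μ : ∀ i, Measure (X i)} [∀ i, IsProbabilityMeasure (μ i)] {T : ∀ i, ℝ → X i → X i}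

theorem pi_real_inter (t : ℝ) (A B : ∀ i, Set (X i)) :
    (Measure.pi μ).real (Set.univ.pi A ∩ pi T t ⁻¹' Set.univ.pi B) =
      ∏ i, (μ i).real (A i ∩ T i t ⁻¹' B i) := by
  rw [Measure.real, show Set.univ.pi A ∩ pi T t ⁻¹' Set.univ.pi B =
    Set.univ.pi fun i => A i ∩ T i t ⁻¹' B i by ext x; simp [pi, forall_and], Measure.pi_pi,
    ENNReal.toReal_prod]
  rfl

theorem IsMeasurableFlow.measurePreserving_pi (hT : ∀ i, IsMeasurableFlow (T i) (μ i)) (t : ℝ) :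
    MeasurePreserving (pi T t) (Measure.pi μ) (Measure.pi μ) :=
  MeasureTheory.measurePreserving_pi μ μ fun i => (hT i).measurePreserving t

/-- Continuity at `s` is convergence of the graph couplings along `𝓝 s`, which need only be checked
on boxes. -/
theorem IsMeasurableFlow.pi (hT : ∀ i, IsMeasurableFlow (T i) (μ i)) :
    IsMeasurableFlow (MeasFlow.pi T) (Measure.pi μ) := by
  have hmp := measurePreserving_pi hT
  refine isMeasurableFlow_of_continuous_real_inter
    (fun x => funext fun i => (hT i).map_zero _)
    (fun s t x => funext fun i => (hT i).map_add _ _ _) hmp fun A B hA hB => ?_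
  refine continuous_iff_continuousAt.2 fun s => ?_
  have hg := fun t => @graph_real_prod _ _ (Measure.pi μ) (MeasFlow.pi T t) (hmp t).measurable
  have := (isNullClass_tendsto (𝓝 s)).of_piSystem_prod (fun t => isSelfCoupling_graph (hmp t))
    (isSelfCoupling_graph (hmp s)) generateFrom_pi.symm isPiSystem_pi ?_ hA hB
  · simp only [hg _ hA hB] at this
    exact tendsto_sub_nhds_zero_iff.1 this
  · rintro _ ⟨A, hA, rfl⟩ _ ⟨B, hB, rfl⟩
    rw [Set.mem_univ_pi] at hA hB
    simp only [hg _ (MeasurableSet.univ_pi hA) (MeasurableSet.univ_pi hB), pi_real_inter]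
    refine tendsto_sub_nhds_zero_iff.2 (Continuous.tendsto ?_ s)
    exact continuous_finsetProd _ fun i _ => (hT i).continuous_real_inter (hA i) (hB i)

theorem IsWeaklyMixing.pi (hT : ∀ i, IsMeasurableFlow (T i) (μ i))
    (hTw : ∀ i, IsWeaklyMixing (T i) (μ i)) : IsWeaklyMixing (MeasFlow.pi T) (Measure.pi μ) := by
  refine isWeaklyMixing_of_piSystem (IsMeasurableFlow.measurePreserving_pi hT)
    generateFrom_pi.symm isPiSystem_pi ?_
  rintro _ ⟨A, hA, rfl⟩ _ ⟨B, hB, rfl⟩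
  rw [Set.mem_univ_pi] at hA hB
  have h1 : ∀ A : ∀ i, Set (X i), (Measure.pi μ).real (Set.univ.pi A) = ∏ i, (μ i).real (A i) := by
    intro A
    rw [Measure.real, Measure.pi_pi, ENNReal.toReal_prod]
    rfl
  simp only [pi_real_inter, h1, ← Finset.prod_mul_distrib]
  refine cesaroNull_prod _
    (fun i => (isWeaklyMixing_iff_cesaroNull (hT i)).1 (hTw i) _ _ (hA i) (hB i)) (fun i => ?_)
    fun i t => abs_measureReal_le_one _ _
  rw [abs_mul]
  exact mul_le_one₀ (abs_measureReal_le_one _ _) (abs_nonneg _) (abs_measureReal_le_one _ _)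

end PiFlows

/-! ### The dichotomy given by joining primeness. -/

section JoiningPrimeness

variable {d : ℕ} {Y : Fin d → Type u} [∀ i, MeasurableSpace (Y i)] [∀ i, StandardBorelSpace (Y i)]
  {ν : ∀ i, Measure (Y i)} [∀ i, IsProbabilityMeasure (ν i)] {S : ∀ i, ℝ → Y i → Y i}

/-- A factor with the JP property of a product of weakly mixing flows depends only on the
coordinates in `A`, or only on the others. -/
theorem HasJP.dependsOnAE_or {Z : Type u} [MeasurableSpace Z] [StandardBorelSpace Z]
    {τ : ℝ → Z → Z} {ρ : Measure Z} (hJP : HasJP τ ρ) (hτ : ∀ t, Measurable (τ t))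
    (hS : ∀ i, IsMeasurableFlow (S i) (ν i)) (hSw : ∀ i, IsWeaklyMixing (S i) (ν i))
    {f : (∀ i, Y i) → Z} (hf : MeasurePreserving f (Measure.pi ν) ρ)
    (hint : ∀ t, ∀ᵐ y ∂(Measure.pi ν), f (pi S t y) = τ t (f y)) (A : Finset (Fin d)) :
    DependsOnAE ν A f ∨ DependsOnAE ν Aᶜ f := by
  set P := Measure.pi ν with hP
  set r := MeasurableEquiv.piEquivPiSubtypeProd Y (· ∈ A) with hr
  have hrP : MeasurePreserving r P ((Measure.pi fun i : {i // i ∈ A} => ν i).prod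
    (Measure.pi fun i : {i // i ∉ A} => ν i)) := by
    convert measurePreserving_piEquivPiSubtypeProd ν (· ∈ A)
  set S₁ : ℝ → (∀ i : {i // i ∈ A}, Y i) → ∀ i : {i // i ∈ A}, Y i := pi fun i => S i with hS₁
  set S₂ : ℝ → (∀ i : {i // i ∉ A}, Y i) → ∀ i : {i // i ∉ A}, Y i := pi fun i => S i with hS₂
  have hfl₁ := IsMeasurableFlow.pi fun i : {i // i ∈ A} => hS i
  have hfl₂ := IsMeasurableFlow.pi fun i : {i // i ∉ A} => hS i
  have hw₁ := IsWeaklyMixing.pi (fun i : {i // i ∈ A} => hS i) fun i => hSw i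
  have hw₂ := IsWeaklyMixing.pi (fun i : {i // i ∉ A} => hS i) fun i => hSw i
  have hrS : ∀ t y, r (pi S t y) = prod S₁ S₂ t (r y) := fun t y => rfl
  have hg : Measurable fun y => (f y, r y) := hf.measurable.prodMk r.measurable
  have hgP : MeasurePreserving (fun y => (f y, r y)) P (P.map fun y => (f y, r y)) := ⟨hg, rfl⟩
  have hint' : ∀ t, ∀ᵐ y ∂P, (f (pi S t y), r (pi S t y)) =
      prod τ (prod S₁ S₂) t (f y, r y) := fun t => by
    filter_upwards [hint t] with y hy
    rw [hy, hrS]; rfl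
  have hSt : ∀ t, Measurable (prod τ (prod S₁ S₂) t) := fun t => by
    have h1 := hτ t
    have h2 : Measurable (S₁ t) := (hfl₁.measurePreserving t).measurable
    have h3 : Measurable (S₂ t) := (hfl₂.measurePreserving t).measurable
    unfold prod
    fun_prop
  have hjoin : IsJoining τ ρ (prod S₁ S₂) ((Measure.pi fun i : {i // i ∈ A} => ν i).prod
      (Measure.pi fun i : {i // i ∉ A} => ν i)) (P.map fun y => (f y, r y)) := by
    refine ⟨fun t => ?_, ?_, ?_⟩
    · have hpi := IsMeasurableFlow.measurePreserving_pi hS t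
      rw [Measure.map_map (hSt t) hg]
      conv_rhs => rw [hP, ← hpi.map_eq, Measure.map_map hg hpi.measurable]
      exact (Measure.map_congr (hint' t)).symm
    · rw [Measure.map_map measurable_fst hg]; exact hf.map_eq
    · rw [Measure.map_map measurable_snd hg]; exact hrP.map_eq
  have herg : IsErgodic (prod τ (prod S₁ S₂)) (P.map fun y => (f y, r y)) :=
    (IsWeaklyMixing.pi hS hSw).isErgodic.factor hgP hint'
  -- The first coordinate is a function of the others almost everywhere for the joining; this is
  -- tested below against the product form provided by JP.
  have hgraph : ∀ᵐ p ∂(P.map fun y => (f y, r y)), f (r.symm p.2) = p.1 := by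
    refine (ae_map_iff hg.aemeasurable (measurableSet_eq_fun
      ((hf.measurable.comp r.symm.measurable).comp measurable_snd) measurable_fst)).2 ?_
    exact ae_of_all _ fun y => congrArg f (r.symm_apply_apply y)
  have hm₁ : MeasurePreserving (fun y : ∀ i, Y i => fun i : {i // i ∈ A} => y i) P
    (Measure.pi fun i : {i // i ∈ A} => ν i) := measurePreserving_fst.comp hrP
  have hm₂ : MeasurePreserving (fun y : ∀ i, Y i => fun i : {i // i ∉ A} => y i) P
    (Measure.pi fun i : {i // i ∉ A} => ν i) := measurePreserving_snd.comp hrP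
  rcases hJP.joining _ _ _ _ S₁ S₂ hfl₁ hfl₂ hw₁ hw₂ _ hjoin herg with h | h
  · left
    have hk : Measurable fun y : ∀ i, Y i => (f y, fun i : {i // i ∈ A} => y i) :=
      hf.measurable.prodMk hm₁.measurable
    -- A typical point of the product is `f y`, the `A`-part of `y` and the `Aᶜ`-part of an
    -- independent `y'`, so `hgraph` reads `f (A.piecewise y y') = f y`.
    rw [h, Measure.map_map (by fun_prop) hg, ← hm₂.map_eq] at hgraph
    change ∀ᵐ p ∂(((P.map fun y => (f y, fun i : {i // i ∈ A} => y i)).prod _).map _), _ at hgraph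
    rw [Measure.map_prod_map _ _ hk hm₂.measurable,
      Measure.map_map (by fun_prop) (hk.prodMap hm₂.measurable)] at hgraph
    filter_upwards [ae_of_ae_map (Measurable.aemeasurable (by
      exact Measurable.comp (by fun_prop) (hk.prodMap hm₂.measurable))) hgraph] with p hp
    exact hp
  · right
    have hk : Measurable fun y : ∀ i, Y i => (f y, fun i : {i // i ∉ A} => y i) :=
      hf.measurable.prodMk hm₂.measurable
    rw [h, Measure.map_map (by fun_prop) hg, ← hm₁.map_eq] at hgraph
    change ∀ᵐ p ∂(((P.map fun y => (f y, fun i : {i // i ∉ A} => y i)).prod _).map _), _ at hgraph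
    rw [Measure.map_prod_map _ _ hk hm₁.measurable,
      Measure.map_map (by fun_prop) (hk.prodMap hm₁.measurable)] at hgraph
    filter_upwards [ae_of_ae_map (Measurable.aemeasurable (by
      exact Measurable.comp (by fun_prop) (hk.prodMap hm₁.measurable))) hgraph] with p hp
    rw [Finset.piecewise_compl]
    exact hp

/-- If no singleton works, every `{j}ᶜ` does, hence so does their intersection `∅`, and then any
singleton by monotonicity. -/
theorem exists_dependsOnAE_singleton {Z : Type*} [MeasurableSpace Z] [StandardBorelSpace Z]
    {f : (∀ i, Y i) → Z} (hf : Measurable f) [Nonempty (Fin d)]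
    (h : ∀ A, DependsOnAE ν A f ∨ DependsOnAE ν Aᶜ f) : ∃ j, DependsOnAE ν {j} f := by
  by_contra! hne
  have h1 : ∀ B : Finset (Fin d), DependsOnAE ν Bᶜ f := by
    intro B
    induction B using Finset.induction_on with
    | empty => exact Eventually.of_forall fun p => by rw [Finset.piecewise_compl, Finset.piecewise_empty]
    | insert j B _ ih =>
      rw [Finset.insert_eq, Finset.compl_union]
      exact ((h {j}).resolve_left (hne j)).inter hf ih
  have h2 := h1 Finset.univ
  exact hne (Classical.arbitrary _) (h2.mono hf (by simp))

end JoiningPrimeness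

/-! ### Conclusion under joining primeness. -/

section CaseJP

variable {d : ℕ} {X Y : Fin d → Type u} [∀ i, MeasurableSpace (X i)] [∀ i, MeasurableSpace (Y i)]
  [∀ i, StandardBorelSpace (X i)] [∀ i, StandardBorelSpace (Y i)]
  {μ : ∀ i, Measure (X i)} {ν : ∀ i, Measure (Y i)}
  [∀ i, IsProbabilityMeasure (μ i)] [∀ i, IsProbabilityMeasure (ν i)]
  {Φ : (∀ i, Y i) → ∀ i, X i}

theorem exists_restrictsToCoordinates {T : ∀ i, ℝ → X i → X i} {S : ∀ i, ℝ → Y i → Y i}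
    (hT : ∀ i, IsMeasurableFlow (T i) (μ i)) (hS : ∀ i, IsMeasurableFlow (S i) (ν i))
    (hν : ∀ i, IsNontrivial (ν i))
    (hΦ : IsIsomorphism (pi S) (Measure.pi ν) (pi T) (Measure.pi μ) Φ)
    {j : Fin d → Fin d} (hj : ∀ i, DependsOnAE ν {j i} fun y => Φ y i) :
    ∃ σ : Equiv.Perm (Fin d), RestrictsToCoordinates S ν T μ Φ σ := by
  obtain ⟨Ψ, hΨ, hΨΦ, hΦΨ⟩ := hΦ.exists_inverse
  have hsurj := surjective_of_dependsOnAE hν hΦ.measurePreserving.measurable hΨΦ hj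
  exact ⟨Equiv.ofBijective j (Finite.injective_iff_bijective.1
    (Finite.injective_iff_surjective.2 hsurj)), restrictsToCoordinates_of_dependsOnAE
    (fun i => (hS i).measurePreserving) (fun i t => ((hT i).measurePreserving t).measurable)
    hΦ.measurePreserving hΨ hΨΦ hΦ.intertwines _ hj⟩

theorem exists_restrictsToCoordinates_of_hasJP {T : ∀ i, ℝ → X i → X i} {S : ∀ i, ℝ → Y i → Y i}
    (hT : ∀ i, IsMeasurableFlow (T i) (μ i)) (hS : ∀ i, IsMeasurableFlow (S i) (ν i))
    (hν : ∀ i, IsNontrivial (ν i))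
    (hΦ : IsIsomorphism (pi S) (Measure.pi ν) (pi T) (Measure.pi μ) Φ)
    (hTw : ∀ i, IsWeaklyMixing (T i) (μ i)) (hJP : ∀ i, HasJP (T i) (μ i)) :
    ∃ σ : Equiv.Perm (Fin d), RestrictsToCoordinates S ν T μ Φ σ := by
  obtain ⟨Ψ, hΨ, hΨΦ, hΦΨ⟩ := hΦ.exists_inverse
  -- JP only concerns weakly mixing partners; each `S i` is one, being a factor of the product of
  -- the `T i` through `Ψ`.
  have hSw : ∀ i, IsWeaklyMixing (S i) (ν i) := fun i => by
    refine (IsWeaklyMixing.pi hT hTw).factor ((measurePreserving_eval ν i).comp hΨ)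
      (fun t => ((hS i).measurePreserving t).measurable) fun t => ?_
    filter_upwards [intertwines_inverse hΨ (IsMeasurableFlow.measurePreserving_pi hS) hΨΦ hΦΨ
      hΦ.intertwines t] with x hx
    simp only [Function.comp, hx]
    rfl
  have h : ∀ i, ∃ j, DependsOnAE ν {j} fun y => Φ y i := fun i => by
    have : Nonempty (Fin d) := ⟨i⟩
    have hi := (measurePreserving_eval μ i).comp hΦ.measurePreserving
    refine exists_dependsOnAE_singleton hi.measurable
      ((hJP i).dependsOnAE_or (fun t => ((hT i).measurePreserving t).measurable) hS hSw hi
        fun t => ?_)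
    filter_upwards [hΦ.intertwines t] with y hy
    simp only [hy]
    rfl
  choose j hj using h
  exact exists_restrictsToCoordinates hT hS hν hΦ hj

end CaseJP

/-! ### The resampling coupling as a limit of graph couplings. -/

section ResampleCoupling

/-- The probability that `A` is the set of successes of independent trials, with success
probability `1 - α i` for the `i`-th. -/
noncomputable def bernoulliWeight {ι : Type*} [Fintype ι] [DecidableEq ι] (α : ι → ℝ)
    (A : Finset ι) : ℝ :=
  (∏ i ∈ A, (1 - α i)) * ∏ i ∈ Aᶜ, α i

variable {ι : Type*} [Fintype ι] [DecidableEq ι] {α : ι → ℝ}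

theorem bernoulliWeight_nonneg (hα : ∀ i, α i ∈ Set.Ioo (0 : ℝ) 1) (A : Finset ι) :
    0 ≤ bernoulliWeight α A :=
  mul_nonneg (Finset.prod_nonneg fun i _ => by linarith [(hα i).2])
    (Finset.prod_nonneg fun i _ => (hα i).1.le)

theorem sum_bernoulliWeight_superset (α : ι → ℝ) (B : Finset ι) :
    ∑ A, (if B ⊆ A then bernoulliWeight α A else 0) = ∏ i ∈ B, (1 - α i) := by
  -- Giving failures in `B` weight `0` removes exactly the terms with `¬ B ⊆ A`.
  have h := Finset.prod_add (fun i => 1 - α i) (fun i => if i ∈ B then 0 else α i) Finset.univ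
  rw [Finset.powerset_univ] at h
  calc _ = ∑ A, (∏ i ∈ A, (1 - α i)) * ∏ i ∈ Finset.univ \ A, (if i ∈ B then 0 else α i) := by
        refine Finset.sum_congr rfl fun A _ => ?_
        rw [← Finset.compl_eq_univ_sdiff]
        split_ifs with hBA
        · refine congrArg _ (Finset.prod_congr rfl fun i hi => ?_)
          rw [if_neg fun hiB => Finset.mem_compl.1 hi (hBA hiB)]
        · obtain ⟨i, hiB, hiA⟩ := Finset.not_subset.1 hBA
          rw [Finset.prod_eq_zero (f := fun i => if i ∈ B then (0 : ℝ) else α i)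
            (Finset.mem_compl.2 hiA) (if_pos hiB), mul_zero]
    _ = ∏ i, (1 - α i + if i ∈ B then 0 else α i) := h.symm
    _ = ∏ i, (if i ∈ B then 1 - α i else 1) :=
        Finset.prod_congr rfl fun i _ => by split_ifs <;> ring
    _ = _ := by simp

theorem sum_bernoulliWeight (α : ι → ℝ) : ∑ A, bernoulliWeight α A = 1 := by
  simpa using sum_bernoulliWeight_superset α ∅

variable {X : ι → Type*} [∀ i, MeasurableSpace (X i)] (μ : ∀ i, Measure (X i))
  [∀ i, IsProbabilityMeasure (μ i)]

/-- The law of `(x, x')` where `x'` arises from `x` by resampling the `i`-th coordinate with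
probability `α i`, independently for all `i`. -/
noncomputable def resampleCoupling (α : ι → ℝ) : Measure ((∀ i, X i) × (∀ i, X i)) :=
  ∑ A : Finset ι, ENNReal.ofReal (bernoulliWeight α A) •
    ((Measure.pi μ).prod (Measure.pi μ)).map fun p => (p.1, A.piecewise p.1 p.2)

variable {μ}

theorem resampleCoupling_apply {E : Set ((∀ i, X i) × (∀ i, X i))} (hE : MeasurableSet E) :
    resampleCoupling μ α E = ∑ A : Finset ι, ENNReal.ofReal (bernoulliWeight α A) *
      ((Measure.pi μ).prod (Measure.pi μ)) {p | (p.1, A.piecewise p.1 p.2) ∈ E} := by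
  simp only [resampleCoupling, Measure.coe_finsetSum, Finset.sum_apply, Measure.smul_apply,
    smul_eq_mul]
  refine Finset.sum_congr rfl fun A _ => ?_
  rw [Measure.map_apply (measurable_fst.prodMk (measurable_piecewise A)) hE]
  rfl

theorem resampleCoupling_real (hα : ∀ i, α i ∈ Set.Ioo (0 : ℝ) 1)
    {E : Set ((∀ i, X i) × (∀ i, X i))} (hE : MeasurableSet E) :
    (resampleCoupling μ α).real E = ∑ A : Finset ι, bernoulliWeight α A *
      ((Measure.pi μ).prod (Measure.pi μ)).real {p | (p.1, A.piecewise p.1 p.2) ∈ E} := by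
  rw [Measure.real, resampleCoupling_apply hE, ENNReal.toReal_sum fun A _ =>
    ENNReal.mul_ne_top ENNReal.ofReal_ne_top (measure_ne_top _ _)]
  refine Finset.sum_congr rfl fun A _ => ?_
  rw [ENNReal.toReal_mul, ENNReal.toReal_ofReal (bernoulliWeight_nonneg hα A)]
  rfl

theorem sum_ofReal_bernoulliWeight (hα : ∀ i, α i ∈ Set.Ioo (0 : ℝ) 1) :
    ∑ A, ENNReal.ofReal (bernoulliWeight α A) = 1 := by
  rw [← ENNReal.ofReal_sum_of_nonneg fun A _ => bernoulliWeight_nonneg hα A,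
    sum_bernoulliWeight, ENNReal.ofReal_one]

theorem isSelfCoupling_resampleCoupling (hα : ∀ i, α i ∈ Set.Ioo (0 : ℝ) 1) :
    IsSelfCoupling (Measure.pi μ) (resampleCoupling μ α) where
  map_fst := by
    ext E hE
    rw [Measure.map_apply measurable_fst hE, resampleCoupling_apply (measurable_fst hE)]
    have : ∀ A : Finset ι, ((Measure.pi μ).prod (Measure.pi μ))
        {p | (p.1, A.piecewise p.1 p.2) ∈ Prod.fst ⁻¹' E} = Measure.pi μ E := fun A =>
      (measurePreserving_fst (μ := Measure.pi μ) (ν := Measure.pi μ)).measure_preimage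
        hE.nullMeasurableSet
    simp only [this, ← Finset.sum_mul, sum_ofReal_bernoulliWeight hα, one_mul]
  map_snd := by
    ext E hE
    rw [Measure.map_apply measurable_snd hE, resampleCoupling_apply (measurable_snd hE)]
    have : ∀ A : Finset ι, ((Measure.pi μ).prod (Measure.pi μ))
        {p | (p.1, A.piecewise p.1 p.2) ∈ Prod.snd ⁻¹' E} = Measure.pi μ E := fun A =>
      (measurePreserving_piecewise μ A).measure_preimage hE.nullMeasurableSet
    simp only [this, ← Finset.sum_mul, sum_ofReal_bernoulliWeight hα, one_mul]

theorem isProbabilityMeasure_resampleCoupling (hα : ∀ i, α i ∈ Set.Ioo (0 : ℝ) 1) :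
    IsProbabilityMeasure (resampleCoupling μ α) := by
  refine ⟨?_⟩
  have := (isSelfCoupling_resampleCoupling (μ := μ) hα).prod_univ MeasurableSet.univ
  rwa [Set.univ_prod_univ, measure_univ (μ := Measure.pi μ)] at this

/-- Expanding the product over subsets `A` of kept coordinates gives the mixture. Each factor is the
limit of correlations prescribed by `α i`-weak mixing. -/
theorem resampleCoupling_real_pi (hα : ∀ i, α i ∈ Set.Ioo (0 : ℝ) 1) {E F : ∀ i, Set (X i)}
    (hE : ∀ i, MeasurableSet (E i)) (hF : ∀ i, MeasurableSet (F i)) :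
    (resampleCoupling μ α).real (Set.univ.pi E ×ˢ Set.univ.pi F) =
      ∏ i, (α i * ((μ i).real (E i) * (μ i).real (F i)) + (1 - α i) * (μ i).real (E i ∩ F i)) := by
  rw [resampleCoupling_real hα ((MeasurableSet.univ_pi hE).prod (MeasurableSet.univ_pi hF))]
  simp only [add_comm (α _ * _)]
  rw [Finset.prod_add, Finset.powerset_univ]
  refine Finset.sum_congr rfl fun A _ => ?_
  have h := congrArg ENNReal.toReal (prod_pi_preimage μ A E F)
  rw [ENNReal.toReal_prod] at h
  have h' : ((Measure.pi μ).prod (Measure.pi μ)).real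
      {p | (p.1, A.piecewise p.1 p.2) ∈ Set.univ.pi E ×ˢ Set.univ.pi F} =
      ∏ i, if i ∈ A then (μ i).real (E i ∩ F i) else (μ i).real (E i) * (μ i).real (F i) := by
    refine Eq.trans h (Finset.prod_congr rfl fun i _ => ?_)
    split_ifs
    · rfl
    · exact ENNReal.toReal_mul
  rw [h', ← Finset.compl_eq_univ_sdiff, Finset.prod_mul_distrib, Finset.prod_mul_distrib,
    bernoulliWeight, ← Finset.prod_mul_prod_compl A, Finset.prod_ite_of_true (fun i hi => hi),
    Finset.prod_ite_of_false fun i hi => Finset.mem_compl.1 hi]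
  ring

theorem IsAlphaWeaklyMixing.tendsto_real {X : Type*} [MeasurableSpace X] {μ : Measure X}
    [IsProbabilityMeasure μ] {T : ℝ → X → X} {a : ℝ} {t : ℕ → ℝ} (hT : IsMeasurableFlow T μ)
    (h : IsAlphaWeaklyMixing T μ a t) {A B : Set X} (hA : MeasurableSet A) (hB : MeasurableSet B) :
    Tendsto (fun n => μ.real (A ∩ T (t n) ⁻¹' B)) atTop
      (𝓝 (a * (μ.real A * μ.real B) + (1 - a) * μ.real (A ∩ B))) := by
  have h1 := h _ _ (memLp_indicator_one μ hB) (memLp_indicator_one μ hA)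
  have h2 : ∫ x, starRingEnd ℂ (A.indicator (fun _ => (1 : ℂ)) x) ∂μ = (μ.real A : ℂ) := by
    simpa using integral_indicator_comp_mul (MeasurePreserving.id μ) hA MeasurableSet.univ
  have h3 : ∫ x, B.indicator (fun _ => (1 : ℂ)) x ∂μ = (μ.real B : ℂ) := by
    simpa using integral_indicator_comp_mul (MeasurePreserving.id μ) MeasurableSet.univ hB
  have h4 := integral_indicator_comp_mul (MeasurePreserving.id μ) hA hB
  simp only [id, Set.preimage_id_eq] at h4
  simp only [integral_indicator_comp_mul (hT.measurePreserving _) hA hB, h2, h3, h4] at h1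
  have h5 : (a : ℂ) * ((μ.real B : ℂ) * μ.real A) + (1 - (a : ℂ)) * μ.real (A ∩ B) =
      ((a * (μ.real A * μ.real B) + (1 - a) * μ.real (A ∩ B) : ℝ) : ℂ) := by
    push_cast
    ring
  rw [h5] at h1
  exact (Complex.continuous_re.tendsto _).comp h1

theorem tendsto_real_resampleCoupling {T : ∀ i, ℝ → X i → X i} {t : ℕ → ℝ}
    (hα : ∀ i, α i ∈ Set.Ioo (0 : ℝ) 1) (hT : ∀ i, IsMeasurableFlow (T i) (μ i))
    (h : ∀ i, IsAlphaWeaklyMixing (T i) (μ i) (α i) t) {A B : Set (∀ i, X i)}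
    (hA : MeasurableSet A) (hB : MeasurableSet B) :
    Tendsto (fun n => (Measure.pi μ).real (A ∩ pi T (t n) ⁻¹' B)) atTop
      (𝓝 ((resampleCoupling μ α).real (A ×ˢ B))) := by
  have hmp := IsMeasurableFlow.measurePreserving_pi hT
  have hg := fun t => @graph_real_prod _ _ (Measure.pi μ) (pi T t) (hmp t).measurable
  have := (isNullClass_tendsto atTop).of_piSystem_prod
    (fun n => isSelfCoupling_graph (hmp (t n))) (isSelfCoupling_resampleCoupling hα)
    generateFrom_pi.symm isPiSystem_pi ?_ hA hB
  · simp only [hg _ hA hB] at this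
    exact tendsto_sub_nhds_zero_iff.1 this
  · rintro _ ⟨A, hA, rfl⟩ _ ⟨B, hB, rfl⟩
    rw [Set.mem_univ_pi] at hA hB
    simp only [hg _ (MeasurableSet.univ_pi hA) (MeasurableSet.univ_pi hB), pi_real_inter]
    refine tendsto_sub_nhds_zero_iff.2 ?_
    rw [resampleCoupling_real_pi hα hA hB]
    exact tendsto_finsetProd _ fun i _ => (h i).tendsto_real (hT i) (hA i) (hB i)

section Dependence

variable {Z : Type*} [MeasurableSpace Z] [StandardBorelSpace Z] {f : (∀ i, X i) → Z}

/-- By ergodicity of the product of the flow with itself, resampling changes `f` almost never or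
almost always. -/
theorem real_resample_eq_ite {T : ∀ i, ℝ → X i → X i} {τ : ℝ → Z → Z}
    (hT : ∀ i, IsMeasurableFlow (T i) (μ i)) (hTw : IsWeaklyMixing (pi T) (Measure.pi μ))
    (hτ : ∀ t, Function.Injective (τ t)) (hf : Measurable f)
    (hint : ∀ t, ∀ᵐ x ∂Measure.pi μ, f (pi T t x) = τ t (f x)) (A : Finset ι)
    [Decidable (DependsOnAE μ A f)] :
    ((Measure.pi μ).prod (Measure.pi μ)).real {p | f (A.piecewise p.1 p.2) = f p.1} =
      if DependsOnAE μ A f then 1 else 0 := by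
  set P := Measure.pi μ
  have hfl := IsMeasurableFlow.pi hT
  have herg := (hTw.prod hfl hfl hTw).isErgodic
  have hmeas := measurableSet_resample (Y := X) hf A
  -- Resampling commutes with the product flow, and injectivity of `τ t` makes the event invariant
  -- in both directions.
  have hinv : ∀ t, prod (pi T) (pi T) t ⁻¹' {p | f (A.piecewise p.1 p.2) = f p.1} =ᵐ[P.prod P]
      ({p | f (A.piecewise p.1 p.2) = f p.1} : Set _) := by
    intro t
    filter_upwards [(measurePreserving_piecewise μ A).quasiMeasurePreserving.ae (hint t),
      measurePreserving_fst.quasiMeasurePreserving.ae (hint t)] with p h1 h2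
    refine propext ?_
    change f (A.piecewise (pi T t p.1) (pi T t p.2)) = f (pi T t p.1) ↔
      f (A.piecewise p.1 p.2) = f p.1
    have h3 : A.piecewise (pi T t p.1) (pi T t p.2) = pi T t (A.piecewise p.1 p.2) := by
      ext i
      by_cases hi : i ∈ A <;> simp [Finset.piecewise, pi, hi]
    rw [h3, h1, h2, (hτ t).eq_iff]
  split_ifs with hA
  · rw [measureReal_congr (t := Set.univ) (eventuallyEq_univ.2 hA)]
    simp
  · rcases herg _ hmeas hinv with h0 | h0
    · exact (congrArg ENNReal.toReal h0).trans ENNReal.toReal_zero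
    · exact absurd h0 hA

/-- Closure under intersections and supersets makes these sets a filter on a finite set, hence
principal. -/
theorem exists_minimal_dependsOnAE (hf : Measurable f) :
    ∃ B, ∀ A, DependsOnAE μ A f ↔ B ⊆ A := by
  classical
  have huniv : DependsOnAE μ Finset.univ f := Eventually.of_forall fun p => by simp
  have hB : DependsOnAE μ ((Finset.univ.filter fun A => DependsOnAE μ A f).inf id) f :=
    Finset.inf_induction (p := fun A => DependsOnAE μ A f) huniv
      (fun A hA B hB => hA.inter hf hB) fun A hA => (Finset.mem_filter.1 hA).2
  refine ⟨_, fun A => ⟨fun hA => ?_, fun hA => hB.mono hf hA⟩⟩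
  exact Finset.inf_le (f := id) (Finset.mem_filter.2 ⟨Finset.mem_univ _, hA⟩)

end Dependence

end ResampleCoupling

/-! ### Conclusion under partial weak mixing. -/

section CaseAlpha

variable {d : ℕ} {X Y : Fin d → Type u} [∀ i, MeasurableSpace (X i)] [∀ i, MeasurableSpace (Y i)]
  [∀ i, StandardBorelSpace (X i)] [∀ i, StandardBorelSpace (Y i)]
  {μ : ∀ i, Measure (X i)} {ν : ∀ i, Measure (Y i)}
  [∀ i, IsProbabilityMeasure (μ i)] [∀ i, IsProbabilityMeasure (ν i)]
  {T : ∀ i, ℝ → X i → X i} {S : ∀ i, ℝ → Y i → Y i}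
  {α : Fin d → ℝ} {t : ℕ → ℝ} {Ψ : (∀ i, X i) → ∀ i, Y i}

theorem tendsto_real_resampleCoupling_factor (hα : ∀ i, α i ∈ Set.Ioo (0 : ℝ) 1)
    (hT : ∀ i, IsMeasurableFlow (T i) (μ i)) (hS : ∀ i, IsMeasurableFlow (S i) (ν i))
    (h : ∀ i, IsAlphaWeaklyMixing (T i) (μ i) (α i) t)
    (hΨ : MeasurePreserving Ψ (Measure.pi μ) (Measure.pi ν))
    (hint : ∀ s, ∀ᵐ x ∂Measure.pi μ, Ψ (pi T s x) = pi S s (Ψ x))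
    {A B : Set (∀ i, Y i)} (hA : MeasurableSet A) (hB : MeasurableSet B) :
    Tendsto (fun n => (Measure.pi ν).real (A ∩ pi S (t n) ⁻¹' B)) atTop
      (𝓝 ((resampleCoupling μ α).real ((Ψ ⁻¹' A) ×ˢ (Ψ ⁻¹' B)))) := by
  have := tendsto_real_resampleCoupling hα hT h (hΨ.measurable hA) (hΨ.measurable hB)
  simpa only [measureReal_inter_factor hΨ
    (IsMeasurableFlow.measurePreserving_pi hS _).measurable (hint _) hA hB] using this

/-- The pairs of corresponding coordinates are independent under the resampling coupling. -/
theorem indepFun_resampleCoupling (hα : ∀ i, α i ∈ Set.Ioo (0 : ℝ) 1)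
    (hT : ∀ i, IsMeasurableFlow (T i) (μ i)) (hS : ∀ i, IsMeasurableFlow (S i) (ν i))
    (h : ∀ i, IsAlphaWeaklyMixing (T i) (μ i) (α i) t)
    (hΨ : MeasurePreserving Ψ (Measure.pi μ) (Measure.pi ν))
    (hint : ∀ s, ∀ᵐ x ∂Measure.pi μ, Ψ (pi T s x) = pi S s (Ψ x)) {j k : Fin d} (hjk : j ≠ k) :
    ProbabilityTheory.IndepFun (fun p => (Ψ p.1 j, Ψ p.2 j)) (fun p => (Ψ p.1 k, Ψ p.2 k))
      (resampleCoupling μ α) := by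
  have := isProbabilityMeasure_resampleCoupling (μ := μ) hα
  have hm : ∀ j, Measurable fun p : (∀ i, X i) × (∀ i, X i) => (Ψ p.1 j, Ψ p.2 j) := fun j => by
    have := hΨ.measurable
    fun_prop
  have hlim := fun A B hA hB =>
    tendsto_real_resampleCoupling_factor (A := A) (B := B) hα hT hS h hΨ hint hA hB
  refine ProbabilityTheory.IndepSets.indep (hm j).comap_le (hm k).comap_le
    (isPiSystem_prod.comap _) (isPiSystem_prod.comap _)
    (by rw [← generateFrom_prod, MeasurableSpace.comap_generateFrom]; rfl)
    (by rw [← generateFrom_prod, MeasurableSpace.comap_generateFrom]; rfl) ?_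
  rw [ProbabilityTheory.IndepSets_iff]
  rintro _ _ ⟨_, ⟨C, hC, D, hD, rfl⟩, rfl⟩ ⟨_, ⟨C', hC', D', hD', rfl⟩, rfl⟩
  simp only [Set.mem_ofPred_eq] at hC hD hC' hD'
  have he : ∀ j, Measurable (Function.eval j : (∀ i, Y i) → Y j) := fun j => measurable_pi_apply j
  have h1 := hlim _ _ (he j hC) (he j hD)
  have h2 := hlim _ _ (he k hC') (he k hD')
  have h3 := hlim _ _ ((he j hC).inter (he k hC')) ((he j hD).inter (he k hD'))
  -- At each time the flow acts separately on the coordinates `j` and `k`, which are independent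
  -- under `Measure.pi ν`; the factorisation survives the limit.
  have hind : ∀ s, (Measure.pi ν).real
      ((Function.eval j ⁻¹' C ∩ Function.eval k ⁻¹' C') ∩
        pi S s ⁻¹' (Function.eval j ⁻¹' D ∩ Function.eval k ⁻¹' D')) =
      (Measure.pi ν).real (Function.eval j ⁻¹' C ∩ pi S s ⁻¹' (Function.eval j ⁻¹' D)) *
      (Measure.pi ν).real (Function.eval k ⁻¹' C' ∩ pi S s ⁻¹' (Function.eval k ⁻¹' D')) := by
    intro s
    have hi := (ProbabilityTheory.iIndepFun_pi (μ := ν) (X := fun i (y : Y i) => y)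
      fun i => aemeasurable_id).indepFun hjk
    have hi' := hi.measure_inter_preimage_eq_mul (C ∩ S j s ⁻¹' D) (C' ∩ S k s ⁻¹' D')
      (hC.inter (((hS j).measurePreserving s).measurable hD))
      (hC'.inter (((hS k).measurePreserving s).measurable hD'))
    rw [Measure.real, Measure.real, Measure.real, ← ENNReal.toReal_mul]
    refine congrArg _ (Eq.trans (congrArg _ ?_) hi')
    ext y
    simp only [Set.mem_inter_iff, Set.mem_preimage, Function.eval, pi]
    tauto
  simp only [hind] at h3
  have h4 := tendsto_nhds_unique h3 (h1.mul h2)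
  have hset : ∀ (j : Fin d) (C D : Set (Y j)),
      (Ψ ⁻¹' (Function.eval j ⁻¹' C)) ×ˢ (Ψ ⁻¹' (Function.eval j ⁻¹' D)) =
      (fun p : (∀ i, X i) × (∀ i, X i) => (Ψ p.1 j, Ψ p.2 j)) ⁻¹' (C ×ˢ D) := fun _ _ _ => rfl
  rw [Set.preimage_inter, Set.preimage_inter, ← Set.prod_inter_prod, hset, hset] at h4
  rw [← ENNReal.toReal_eq_toReal_iff' (measure_ne_top _ _)
    (ENNReal.mul_ne_top (measure_ne_top _ _) (measure_ne_top _ _)), ENNReal.toReal_mul]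
  exact h4

theorem exists_restrictsToCoordinates_of_isAlphaWeaklyMixing {Φ : (∀ i, Y i) → ∀ i, X i}
    (hT : ∀ i, IsMeasurableFlow (T i) (μ i)) (hS : ∀ i, IsMeasurableFlow (S i) (ν i))
    (hν : ∀ i, IsNontrivial (ν i))
    (hΦ : IsIsomorphism (pi S) (Measure.pi ν) (pi T) (Measure.pi μ) Φ)
    (hα : ∀ i, α i ∈ Set.Ioo (0 : ℝ) 1)
    (h : ∀ i, IsAlphaWeaklyMixing (T i) (μ i) (α i) t)
    (hSw : ∀ i, IsWeaklyMixing (S i) (ν i)) :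
    ∃ σ : Equiv.Perm (Fin d), RestrictsToCoordinates S ν T μ Φ σ := by
  classical
  obtain ⟨Ψ, hΨ, hΨΦ, hΦΨ⟩ := hΦ.exists_inverse
  have hTw : IsWeaklyMixing (pi T) (Measure.pi μ) := (IsWeaklyMixing.pi hS hSw).factor
    hΦ.measurePreserving (fun s => (IsMeasurableFlow.measurePreserving_pi hT s).measurable)
    hΦ.intertwines
  have hint := intertwines_inverse hΨ (IsMeasurableFlow.measurePreserving_pi hS) hΨΦ hΦΨ
    hΦ.intertwines
  have hm : ∀ j, Measurable fun x => Ψ x j := fun j => (measurable_pi_apply j).comp hΨ.measurable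
  have hinj : ∀ j s, Function.Injective (S j s) := fun j s => by
    refine Function.LeftInverse.injective (g := S j (-s)) fun y => ?_
    rw [← (hS j).map_add, neg_add_cancel, (hS j).map_zero]
  choose B hB using fun j => exists_minimal_dependsOnAE (μ := μ) (hm j)
  have hite := fun j A => real_resample_eq_ite hT hTw (hinj j) (hm j)
    (fun s => (hint s).mono fun x hx => by rw [hx]; rfl) A
  have hE : ∀ j, MeasurableSet {p : (∀ i, X i) × (∀ i, X i) | Ψ p.1 j = Ψ p.2 j} := fun j =>
    measurableSet_eq_fun ((hm j).comp measurable_fst) ((hm j).comp measurable_snd)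
  -- Keeping the coordinates in `A` preserves `Ψ · j` with probability one if `B j ⊆ A` and zero
  -- otherwise, so this is the probability that all of `B j` is kept.
  have hκ : ∀ j, (resampleCoupling μ α).real {p | Ψ p.1 j = Ψ p.2 j} =
      ∏ i ∈ B j, (1 - α i) := fun j => by
    rw [resampleCoupling_real hα (hE j), ← sum_bernoulliWeight_superset]
    refine Finset.sum_congr rfl fun A _ => ?_
    have := hite j A
    simp only [eq_comm (a := Ψ (A.piecewise _ _) j)] at this
    simp only [Set.mem_ofPred_eq, this, hB]
    split_ifs <;> simp
  have hκ₂ : ∀ j k, (resampleCoupling μ α).real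
      ({p | Ψ p.1 j = Ψ p.2 j} ∩ {p | Ψ p.1 k = Ψ p.2 k}) =
      ∏ i ∈ B j ∪ B k, (1 - α i) := fun j k => by
    rw [resampleCoupling_real hα ((hE j).inter (hE k)), ← sum_bernoulliWeight_superset]
    refine Finset.sum_congr rfl fun A _ => ?_
    have hj := hite j A
    have hk := hite k A
    simp only [eq_comm (a := Ψ (A.piecewise _ _) _), hB] at hj hk
    have hfull : ∀ j, B j ⊆ A → ∀ᵐ p ∂((Measure.pi μ).prod (Measure.pi μ)),
        Ψ p.1 j = Ψ (A.piecewise p.1 p.2) j := fun j hj => by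
      filter_upwards [(hB j A).2 hj] with p hp using hp.symm
    by_cases h1 : B j ⊆ A
    · by_cases h2 : B k ⊆ A
      · rw [if_pos (Finset.union_subset h1 h2), measureReal_congr (t := Set.univ)]
        · simp
        · exact eventuallyEq_univ.2 ((hfull j h1).and (hfull k h2))
      · rw [if_neg fun h => h2 (Finset.union_subset_iff.1 h).2, measureReal_mono_null ?_ (hk.trans (if_neg h2)), mul_zero]
        exact fun p hp => hp.2
    · rw [if_neg fun h => h1 (Finset.union_subset_iff.1 h).1, measureReal_mono_null ?_ (hj.trans (if_neg h1)), mul_zero]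
      exact fun p hp => hp.1
  -- Independence of the two diagonal events gives `∏ i ∈ B j ∩ B k, (1 - α i) = 1`, impossible once
  -- a factor below `1` occurs.
  have hdisj : ∀ j k, j ≠ k → Disjoint (B j) (B k) := fun j k hjk => by
    have hi := (indepFun_resampleCoupling hα hT hS h hΨ hint hjk).measure_inter_preimage_eq_mul
      _ _ measurableSet_diagonal measurableSet_diagonal
    have hi' := congrArg ENNReal.toReal hi
    rw [ENNReal.toReal_mul] at hi'
    have h1 : ∏ i ∈ B j ∪ B k, (1 - α i) = (∏ i ∈ B j, (1 - α i)) * ∏ i ∈ B k, (1 - α i) := by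
      rw [← hκ, ← hκ, ← hκ₂]
      exact hi'
    have hpos : ∀ s : Finset (Fin d), 0 < ∏ i ∈ s, (1 - α i) := fun s =>
      Finset.prod_pos fun i _ => by linarith [(hα i).2]
    have h2 := Finset.prod_union_inter (s₁ := B j) (s₂ := B k) (f := fun i => 1 - α i)
    rw [← h1, mul_eq_left₀ (hpos _).ne'] at h2
    rw [Finset.disjoint_left]
    intro i hij hik
    have hmem := Finset.mem_inter.2 ⟨hij, hik⟩
    rw [← Finset.mul_prod_erase _ _ hmem] at h2
    have h3 : ∏ i ∈ (B j ∩ B k).erase i, (1 - α i) ≤ 1 :=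
      Finset.prod_le_one (fun i _ => by linarith [(hα i).2]) fun i _ => by linarith [(hα i).1]
    nlinarith [(hα i).1, (hα i).2, hpos ((B j ∩ B k).erase i)]
  -- With `B j` empty, `Ψ x j` would equal an independent copy of itself, against nontriviality of
  -- `ν j`.
  have hne : ∀ j, (B j).Nonempty := fun j => by
    rw [Finset.nonempty_iff_ne_empty]
    intro h0
    have hdep : DependsOnAE μ ∅ fun x => Ψ x j := (hB j ∅).2 h0.le
    refine not_isNontrivial_of_ae_eq ((measurePreserving_eval ν j).comp hΨ) ?_ (hν j)
    filter_upwards [hdep] with p hp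
    simpa using hp
  -- One point from each of the disjoint sets `B j` defines an injection of `Fin d`, hence a
  -- permutation `τ`, so that `B j` has no room for a point besides `τ j`.
  choose m hm' using hne
  have hminj : Function.Injective m := fun j k hjk => by
    by_contra hne
    exact Finset.disjoint_left.1 (hdisj j k hne) (hm' j) (hjk ▸ hm' k)
  let τ : Equiv.Perm (Fin d) := Equiv.ofBijective m (Finite.injective_iff_bijective.1 hminj)
  have hdep : ∀ j, DependsOnAE μ {τ j} fun x => Ψ x j := fun j => by
    rw [hB]
    intro i hi
    obtain ⟨k, rfl⟩ := τ.surjective i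
    rw [Finset.mem_singleton]
    by_contra hne
    exact Finset.disjoint_left.1 (hdisj k j fun e => hne (e ▸ rfl)) (hm' k) hi
  -- The dependence is known for `Ψ`; the inversion lemma with the roles of `Φ` and `Ψ` exchanged
  -- transfers it to `Φ`.
  have hdep' := dependsOnAE_inverse hΨ hΦ.measurePreserving hΦΨ τ hdep
  refine exists_restrictsToCoordinates hT hS hν hΦ (j := τ.symm) fun i => ?_
  have := hdep' (τ.symm i)
  rwa [τ.apply_symm_apply] at this

end CaseAlpha

end MeasFlow

theorem theorem2 {d : ℕ} {X Y : Fin d → Type u}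
    [∀ i, MeasurableSpace (X i)] [∀ i, MeasurableSpace (Y i)]
    [∀ i, StandardBorelSpace (X i)] [∀ i, StandardBorelSpace (Y i)]
    (μ : ∀ i, Measure (X i)) (ν : ∀ i, Measure (Y i))
    [∀ i, IsProbabilityMeasure (μ i)] [∀ i, IsProbabilityMeasure (ν i)]
    (T : ∀ i, ℝ → X i → X i) (S : ∀ i, ℝ → Y i → Y i)
    (hT : ∀ i, MeasFlow.IsMeasurableFlow (T i) (μ i))
    (hS : ∀ i, MeasFlow.IsMeasurableFlow (S i) (ν i))
    (hν : ∀ i, MeasFlow.IsNontrivial (ν i))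
    (Φ : (∀ i, Y i) → ∀ i, X i)
    (hΦ : MeasFlow.IsIsomorphism (MeasFlow.pi S) (Measure.pi ν)
      (MeasFlow.pi T) (Measure.pi μ) Φ) :
    ((∀ i, MeasFlow.IsWeaklyMixing (T i) (μ i)) → (∀ i, MeasFlow.HasJP (T i) (μ i)) →
      ∃ σ : Equiv.Perm (Fin d), MeasFlow.RestrictsToCoordinates S ν T μ Φ σ) ∧
    (∀ (α : Fin d → ℝ) (t : ℕ → ℝ), (∀ i, α i ∈ Set.Ioo (0 : ℝ) 1) →
      Tendsto t atTop atTop →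
      (∀ i, MeasFlow.IsAlphaWeaklyMixing (T i) (μ i) (α i) t) →
      (∀ i, MeasFlow.IsWeaklyMixing (S i) (ν i)) →
      ∃ σ : Equiv.Perm (Fin d), MeasFlow.RestrictsToCoordinates S ν T μ Φ σ) := by
  exact ⟨MeasFlow.exists_restrictsToCoordinates_of_hasJP hT hS hν hΦ, fun α t hα _ h hSw =>
    MeasFlow.exists_restrictsToCoordinates_of_isAlphaWeaklyMixing hT hS hν hΦ hα h hSw⟩
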